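/- Let $n\ge d\ge 0$ be integers. A standard calibration is a linear map $h:\mathbb R^n\to\mathbb R^d$ with $h(e_i)=e_i$ for $i\le d$; these maps form the space $\mathbb R^{d(n-d)}$. Let $H$ be either the set of standard calibrations with $h(e_i)\ne 0$ for all $i$, or its subset of geometric calibrations, for which moreover the vectors $h(e_i)$ are pairwise non-proportional. For such $h$ let $k:\mathbb R^{n-d}\to\mathbb R^n$ be its Gale transform $k(y)=\bigl(-\sum_j y_j h(e_{d+j}),\,y\bigr)$, so that $0\to\mathbb R^{n-d}\xrightarrow{k}\mathbb R^n\xrightarrow{h}\mathbb R^d\to0$ is exact, and identify $[b]\in\mathbb R^n/\ker k^\top$ with $k^\top b\in\mathbb R^{n-d}$. Let $P_b=\{x\in\mathbb R^d:\langle x,h(e_i)\rangle\ge -b_i\ \forall i\}$ and $$U^{adm}=\{(h,[b]) : h\in H,\ \dim P_b=d\}\subset\mathbb R^{d(n-d)}\times\mathbb R^{n-d}.$$ Let $D$ be a set of subsets of $\{1,\dots,n\}$, $D(1)=\{i:\{i\}\in D\}$ and $\mathcal I=D(1)^c$ (the virtual generators). A standard calibration $h$ is $D$-admissible if the vectors $h(e_i)$,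 $i\in D(1)$, span $\mathbb R^d$ and the cones $\mathrm{Cone}(h(e_i),\,i\in I)$, $I\in D$, form a fan $\Delta_{D,h}$ (of strongly convex cones) whose one-dimensional cones are exactly the half-lines generated by the $h(e_i)$, $i\in D(1)$, and whose combinatorial type (the collection of the sets $\{i\in D(1): h(e_i)\in\sigma\}$, $\sigma\in\Delta_{D,h}$) is $D$. Support functions of a complete fan are the functions $\varphi:\mathbb R^d\to\mathbb R$ that are linear on each cone; with the sign convention of toric geometry, $\varphi$ is called convex if $\varphi(tx+(1-t)y)\ge t\varphi(x)+(1-t)\varphi(y)$ for $t\in[0,1]$, and strictly convex if moreover $\varphi(x+y)>\varphi(x)+\varphi(y)$ whenever $x,y$ lie in no common cone. Let $\Omega(D)$ be the set of the $D$-admissible $h\in H$ such that $\Delta_{D,h}$ is complete and has a strictly convex support function. For $h\in\Omega(D)$ let $\Gamma_{D,h}\subset\mathbb R^{n-d}$ be the image under $k^\top$ of the set of $b\in\mathbb R^n$ for which there is a convex support function $\varphi$ of $\Delta_{D,h}$ with $\varphi(h(e_j))=-b_j$ for $j\notin\mathcal I$ and $\varphi(h(e_i))\ge -b_i$ for $i\in\mathcal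 I$ (the cone of the secondary fan attached to $(\Delta_{D,h},\mathcal I)$), and let $$\widehat\Omega(D)=\{(h,[b])\in U^{adm} : h\in\Omega(D),\ [b]\in\mathrm{Int}\,\Gamma_{D,h}\}.$$ Theorem. Suppose that $D$ is the combinatorial type of a simplicial quantum fan with a standard calibration (that is, $D$ is that of $\Delta_{D,h_0}$ for some $D$-admissible standard calibration $h_0$ with $\Delta_{D,h_0}$ simplicial) which is complete and has a strictly convex support function. Then: 1. $\widehat\Omega(D)$ is an open subset of $U^{adm}$. 2. For $h\in\Omega(D)$ and $b\in\mathbb R^n$, $(h,[b])\in\widehat\Omega(D)$ if and only if $(h,b)$ has the combinatorics $D$, i.e. the sets $\{i:\langle x,h(e_i)\rangle=-b_i\}$, $x\in P_b$, are exactly the elements of $D$. 3. For every $h\in\Omega(D)$ the fiber $\{\chi:(h,\chi)\in\widehat\Omega(D)\}$ is a nonempty open convex cone in $\mathbb R^{n-d}$ (stable under multiplication by positive reals). 4. The projection $\widehat\Omega(D)\to\Omega(D)$ is a locally trivial fibration with fiber $\mathbb R^{n-d}$ and a homotopy equivalence. In particular, if $\Delta_{D,h}$ is complete and has a strictly convex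 support function for every $D$-admissible $h\in H$, then the projection of $\widehat\Omega(D)$ to the set of all $D$-admissible $h\in H$ is a locally trivial fibration with fiber $\mathbb R^{n-d}$ and a homotopy equivalence. -/

import Mathlib

namespace QuantumFan

/-- The index set `{1, …, n}` with `n = d + m`, split into the first `d` and the last
`m = n - d` indices. -/
abbrev Idx (d m : ℕ) : Type := Fin d ⊕ Fin m

/-- `ℝ^d` with its Euclidean structure. -/
abbrev Vec (d : ℕ) : Type := EuclideanSpace ℝ (Fin d)

/-- The space `ℝ^{d(n-d)}` of standard calibrations `h : ℝ^n → ℝ^d`: as `h(e_i) = e_i` for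
`i ≤ d`, such an `h` is given by the images of the last `m = n - d` basis vectors. -/
abbrev Calibration (d m : ℕ) : Type := Fin m → Vec d

/-- The vectors `h(e_i)`. -/
noncomputable def gen {d m : ℕ} (h : Calibration d m) : Idx d m → Vec d :=
  Sum.elim (fun i => EuclideanSpace.single i (1 : ℝ)) h

/-- The linear map `h : ℝ^n → ℝ^d` itself. -/
noncomputable def calibrationMap {d m : ℕ} (h : Calibration d m) :
    (Idx d m → ℝ) →ₗ[ℝ] Vec d :=
  Fintype.linearCombination ℝ (gen h)

/-! ### Gale transform -/

/-- The Gale transform `k : ℝ^{n-d} → ℝ^n` of the standard calibration `h`. -/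
noncomputable def gale {d m : ℕ} (h : Calibration d m) :
    (Fin m → ℝ) →ₗ[ℝ] (Idx d m → ℝ) where
  toFun y := Sum.elim (fun i => -∑ j, y j * h j i) y
  map_add' y z := by
    funext i
    rcases i with i | j
    · simp [add_mul, Finset.sum_add_distrib]; ring
    · simp
  map_smul' c y := by
    funext i
    rcases i with i | j
    · simp [Finset.mul_sum, mul_assoc]
    · simp

/-- The transpose `k^⊤ : ℝ^n → ℝ^{n-d}` of the Gale transform. -/
noncomputable def galeT {d m : ℕ} (h : Calibration d m) :
    (Idx d m → ℝ) →ₗ[ℝ] (Fin m → ℝ) where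
  toFun b := fun j => b (Sum.inr j) - ∑ i, h j i * b (Sum.inl i)
  map_add' b c := by
    funext j
    simp [mul_add, Finset.sum_add_distrib]; ring
  map_smul' c b := by
    funext j
    simp [Finset.mul_sum, mul_sub, mul_left_comm]

theorem galeT_transpose {d m : ℕ} (h : Calibration d m) (b : Idx d m → ℝ) (y : Fin m → ℝ) :
    galeT h b ⬝ᵥ y = b ⬝ᵥ gale h y := by
  simp only [dotProduct, galeT, gale, LinearMap.coe_mk, AddHom.coe_mk, Fintype.sum_sum_type,
    Sum.elim_inl, Sum.elim_inr, sub_mul, Finset.sum_sub_distrib, mul_neg, Finset.sum_neg_distrib,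
    Finset.sum_mul, Finset.mul_sum]
  rw [Finset.sum_comm, sub_eq_add_neg, add_comm]
  congr 2
  exact Finset.sum_congr rfl fun i _ => Finset.sum_congr rfl fun j _ => by ring

theorem calibrationMap_apply {d m : ℕ} (h : Calibration d m) (x : Idx d m → ℝ) (i : Fin d) :
    calibrationMap h x i = x (Sum.inl i) + ∑ j, x (Sum.inr j) * h j i := by
  simp [calibrationMap, Fintype.linearCombination_apply, gen, Fintype.sum_sum_type,
    Pi.single_apply]

/-- The sequence `0 → ℝ^{n-d} → ℝ^n → ℝ^d → 0` given by `k` and `h` is exact. -/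
theorem gale_exact {d m : ℕ} (h : Calibration d m) :
    Function.Injective (gale h) ∧ LinearMap.range (gale h) = LinearMap.ker (calibrationMap h) ∧
      Function.Surjective (calibrationMap h) := by
  refine ⟨fun y z hyz => ?_, ?_, fun v => ?_⟩
  · funext j
    exact congrFun hyz (Sum.inr j)
  · ext x
    simp only [LinearMap.mem_range, LinearMap.mem_ker]
    constructor
    · rintro ⟨y, rfl⟩
      ext i
      rw [calibrationMap_apply]
      simp [gale]
    · intro hx
      refine ⟨fun j => x (Sum.inr j), ?_⟩
      funext i
      rcases i with i | j
      · have h1 := calibrationMap_apply h x i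
        rw [hx] at h1
        simp only [PiLp.zero_apply] at h1
        simp only [gale, LinearMap.coe_mk, AddHom.coe_mk, Sum.elim_inl]
        linarith
      · rfl
  · refine ⟨Sum.elim (fun i => v i) 0, ?_⟩
    ext i
    rw [calibrationMap_apply]
    simp

/-! ### Fans -/

/-- A fan in `ℝ^d`: a finite nonempty family of strongly convex polyhedral cones, stable under
faces, in which two cones meet along a common face. -/
structure IsFan {d : ℕ} (Δ : Set (PointedCone ℝ (Vec d))) : Prop where
  finite : Δ.Finite
  bot_mem : ⊥ ∈ Δ
  fg : ∀ σ ∈ Δ, Submodule.FG σ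
  stronglyConvex : ∀ σ ∈ Δ, (σ : ConvexCone ℝ (Vec d)).Salient
  face_mem : ∀ σ ∈ Δ, ∀ τ : PointedCone ℝ (Vec d), τ.IsFaceOf σ → τ ∈ Δ
  inter_face : ∀ σ ∈ Δ, ∀ τ ∈ Δ, (σ ⊓ τ).IsFaceOf σ

/-- `(Δ, h, 𝓘)` is a quantum fan with set of generators `A = 𝓘ᶜ`: the vectors `h(e_i)`, `i ∈ A`,
span `ℝ^d` and the half-lines they generate are exactly the `1`-dimensional cones of `Δ`. -/
structure IsQuantumFan {d m : ℕ} (Δ : Set (PointedCone ℝ (Vec d))) (h : Calibration d m)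
    (A : Set (Idx d m)) : Prop where
  isFan : IsFan Δ
  span_eq_top : Submodule.span ℝ (gen h '' A) = ⊤
  rays : ∀ ρ : PointedCone ℝ (Vec d),
    (ρ ∈ Δ ∧ Module.finrank ℝ (Submodule.span ℝ (ρ : Set (Vec d))) = 1) ↔
      ∃ i ∈ A, ρ = PointedCone.hull ℝ {gen h i}

/-- The combinatorial type of a quantum fan: its poset of cones, each cone being recorded by the
set of the (non-virtual) generators that lie on it. -/
def combType {d m : ℕ} (Δ : Set (PointedCone ℝ (Vec d))) (h : Calibration d m)
    (A : Set (Idx d m)) : Set (Finset (Idx d m)) :=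
  {I | ∃ σ ∈ Δ, ∀ i, i ∈ I ↔ i ∈ A ∧ gen h i ∈ σ}

/-- `D(1)`, the indices of the `1`-dimensional cones of `D`. The virtual generators are the
indices in the complement. -/
def rayIdx {d m : ℕ} (D : Set (Finset (Idx d m))) : Set (Idx d m) := {i | {i} ∈ D}

/-- The cones `Cone(h(e_i), i ∈ I)` for `I ∈ D`. -/
noncomputable def fanOf {d m : ℕ} (D : Set (Finset (Idx d m))) (h : Calibration d m) :
    Set (PointedCone ℝ (Vec d)) :=
  {σ | ∃ I ∈ D, σ = PointedCone.hull ℝ (gen h '' (I : Set (Idx d m)))}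

/-- `h` is `D`-admissible: there is a quantum fan with calibration `h` and combinatorial type `D`
(this fan is then necessarily `fanOf D h`). -/
def IsAdmissible {d m : ℕ} (D : Set (Finset (Idx d m))) (h : Calibration d m) : Prop :=
  IsQuantumFan (fanOf D h) h (rayIdx D) ∧ combType (fanOf D h) h (rayIdx D) = D

/-! ### Support functions -/

/-- The fan covers `ℝ^d`. -/
def IsComplete {d : ℕ} (Δ : Set (PointedCone ℝ (Vec d))) : Prop := ∀ x, ∃ σ ∈ Δ, x ∈ σ

/-- A support function of a complete fan: a function that is linear on each cone. -/
def IsSupportFunction {d : ℕ} (Δ : Set (PointedCone ℝ (Vec d))) (φ : Vec d → ℝ) : Prop :=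
  ∀ σ ∈ Δ, ∃ l : Vec d →ₗ[ℝ] ℝ, ∀ x ∈ σ, φ x = l x

/-- Convex support functions, with the sign convention of toric geometry, in which "convex" means
`φ (t x + (1 - t) y) ≥ t φ x + (1 - t) φ y` (so that the support function
`u ↦ min_{x ∈ P} ⟪x, u⟫` of a polytope `P = {x | ⟪x, u_i⟫ ≥ -b_i}` is convex and has the values
`-b_i` at the normals `u_i` of the facets). -/
def IsConvexSupportFunction {d : ℕ} (Δ : Set (PointedCone ℝ (Vec d))) (φ : Vec d → ℝ) : Prop :=
  IsSupportFunction Δ φ ∧ ConcaveOn ℝ Set.univ φ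

/-- Strictly convex support functions (same sign convention): the inequality
`φ (x + y) ≥ φ x + φ y` is strict unless `x` and `y` lie in a common cone. -/
def IsStrictlyConvexSupportFunction {d : ℕ} (Δ : Set (PointedCone ℝ (Vec d)))
    (φ : Vec d → ℝ) : Prop :=
  IsConvexSupportFunction Δ φ ∧ ∀ x y, (¬ ∃ σ ∈ Δ, x ∈ σ ∧ y ∈ σ) → φ x + φ y < φ (x + y)

/-- The fan is complete and has a strictly convex support function. -/
def IsPolytopal {d : ℕ} (Δ : Set (PointedCone ℝ (Vec d))) : Prop :=
  IsComplete Δ ∧ ∃ φ, IsStrictlyConvexSupportFunction Δ φ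

/-- `D` is the combinatorial type of a simplicial quantum fan that is complete and has a strictly
convex support function. -/
def IsSimplicialPolytopalType {d m : ℕ} (D : Set (Finset (Idx d m))) : Prop :=
  ∃ h : Calibration d m, IsAdmissible D h ∧ IsPolytopal (fanOf D h) ∧
    ∀ σ ∈ fanOf D h, σ.IsSimplicial

/-! ### The secondary fan -/

/-- The cone `Γ_{(Δ, 𝓘)} ⊆ ℝ^{n-d}` of the secondary fan (GKZ cone) attached to the fan of
combinatorial type `D` with calibration `h`; here `𝓘` is the complement of `D(1)`. -/
def gkzCone {d m : ℕ} (D : Set (Finset (Idx d m))) (h : Calibration d m) : Set (Fin m → ℝ) :=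
  galeT h '' {b | ∃ φ, IsConvexSupportFunction (fanOf D h) φ ∧
    (∀ j ∈ rayIdx D, φ (gen h j) = -b j) ∧ (∀ i ∉ rayIdx D, φ (gen h i) ≥ -b i)}

/-- `P_b = {x | ⟪x, h(e_i)⟫ ≥ -b_i for all i}`. -/
def polytope {d m : ℕ} (h : Calibration d m) (b : Idx d m → ℝ) : Set (Vec d) :=
  {x | ∀ i, inner ℝ x (gen h i) ≥ -b i}

/-- The combinatorics of `(h, b)`: the faces of `P_b`, each recorded by the set of all indices `i`
such that the inequality `⟪x, h(e_i)⟫ ≥ -b_i` is an equality at the points `x` of its relative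
interior. -/
def faceType {d m : ℕ} (h : Calibration d m) (b : Idx d m → ℝ) : Set (Finset (Idx d m)) :=
  {I | ∃ x ∈ polytope h b, ∀ i, i ∈ I ↔ inner ℝ x (gen h i) = -b i}

/-- Standard calibrations all of whose generators are nonzero. -/
def nonzeroCalibrations (d m : ℕ) : Set (Calibration d m) := {h | ∀ i, gen h i ≠ 0}

/-- Geometric calibrations: the generators are nonzero and pairwise non-proportional. -/
def geometricCalibrations (d m : ℕ) : Set (Calibration d m) :=
  {h | (∀ i, gen h i ≠ 0) ∧ ∀ i j, i ≠ j → gen h j ∉ Submodule.span ℝ {gen h i}}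

/-- `U^{adm}`: the pairs `(h, [b])`, `h ∈ H`, such that `P_b` has dimension `d`. The class `[b]` of
`b` in `ℝ^n / ker k^⊤` is identified with the point `k^⊤ b` of `ℝ^{n-d}`. -/
def admissiblePairs {d m : ℕ} (H : Set (Calibration d m)) :
    Set (Calibration d m × (Fin m → ℝ)) :=
  {p | p.1 ∈ H ∧ ∃ b, galeT p.1 b = p.2 ∧ affineSpan ℝ (polytope p.1 b) = ⊤}

/-- The set of all `D`-admissible calibrations in `H`. -/
def admissibleSet {d m : ℕ} (H : Set (Calibration d m)) (D : Set (Finset (Idx d m))) :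
    Set (Calibration d m) :=
  {h | h ∈ H ∧ IsAdmissible D h}

/-- The set of the `D`-admissible calibrations in `H` whose fan of combinatorial type `D` is
complete and has a strictly convex support function. -/
def omega {d m : ℕ} (H : Set (Calibration d m)) (D : Set (Finset (Idx d m))) :
    Set (Calibration d m) :=
  {h | h ∈ admissibleSet H D ∧ IsPolytopal (fanOf D h)}

/-- The set `Ω̂(D)` of the pairs `(h, [b])` in `U^{adm}` with `h ∈ Ω(D)` for which `[b]` lies in the
(open) chamber of the secondary fan of `h` attached to the fan of combinatorial type `D`. -/
def omegaHat {d m : ℕ} (H : Set (Calibration d m)) (D : Set (Finset (Idx d m))) :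
    Set (Calibration d m × (Fin m → ℝ)) :=
  {p | p ∈ admissiblePairs H ∧ p.1 ∈ omega H D ∧ p.2 ∈ interior (gkzCone D p.1)}

/-- The projection `Ω̂(D) → Ω(D)`, `(h, [b]) ↦ h`. -/
def proj {d m : ℕ} (H : Set (Calibration d m)) (D : Set (Finset (Idx d m))) :
    omegaHat H D → omega H D :=
  fun p => ⟨p.1.1, p.2.2.1⟩

/-- The same projection with values in the set of all `D`-admissible calibrations in `H`. -/
def projAdmissible {d m : ℕ} (H : Set (Calibration d m)) (D : Set (Finset (Idx d m))) :
    omegaHat H D → admissibleSet H D :=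
  fun p => ⟨p.1.1, p.2.2.1.1⟩

/-! ### Topology -/

/-- `p` is a locally trivial fibration with fiber `ℝ^m`. -/
def IsRealFibration (m : ℕ) {Z B : Type} [TopologicalSpace Z] [TopologicalSpace B]
    (p : Z → B) : Prop :=
  ∀ x : B, ∃ e : Bundle.Trivialization (Fin m → ℝ) p, x ∈ e.baseSet

/-- `p` is a homotopy equivalence. -/
def IsHomotopyEquivalence {Z B : Type} [TopologicalSpace Z] [TopologicalSpace B]
    (p : Z → B) : Prop :=
  ∃ e : ContinuousMap.HomotopyEquiv Z B, ⇑e.toFun = p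

end QuantumFan

/-! All that is used of `D` is finite combinatorics: being the type of a complete simplicial fan, it
is a pure simplicial complex in which every facet can be left across each of its walls
(`IsThinComplex`). Here a facet is an `I ∈ D` with `d` elements. If the vectors `h(e_i)`, `i ∈ I`,
form a basis for every facet, then `b` determines a point `x_I` with `⟪x_I, h(e_i)⟫ = -b_i` for `i ∈
I`. The slacks `⟪x_I, h(e_i)⟫ + b_i`, `i ∉ I`, are linear in `b` and depend only on `[b]`.

The core is `mem_omegaHat_iff`: `(h, [b])` lies in `Ω̂(D)` iff `h ∈ H`, all facets give bases and
all these slacks are positive. In one direction, `D` is closed under subsets, so every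
`D`-admissible fan is simplicial; a convex support function lies below its linear extension from
each full cone, so the GKZ cone is given by nonnegative slacks and its interior by positive ones
(`interior_gkzCone`). In the other direction, positive slacks rebuild everything: the simplex
algorithm shows that the cones cover `ℝ^d`, comparison of the linear forms `x_I` shows that they
form a fan of type `D`, and the minimum of these forms is strictly convex.

Openness then follows from the continuity of the slacks in `(h, [b])` (Cramer's rule), and the
fibers are open polyhedral cones. A partition of unity gives a continuous section of the family of
cones, and radial stretching by the Minkowski functional centred at it trivializes the family
globally. -/

namespace QuantumFan

/-! ### Simplicial cones, their faces and dual bases. -/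

section Cones

variable {ι V : Type*} [AddCommGroup V] [Module ℝ V]

theorem mem_hull_image {g : ι → V} {I : Finset ι} {v : V} :
    v ∈ PointedCone.hull ℝ (g '' (I : Set ι)) ↔
      ∃ c : ι → ℝ, (∀ i, 0 ≤ c i) ∧ (∀ i ∉ I, c i = 0) ∧ ∑ i ∈ I, c i • g i = v := by
  classical
  constructor
  · intro hv
    induction hv using Submodule.span_induction with
    | mem x hx =>
      obtain ⟨i, hi, rfl⟩ := hx
      refine ⟨Pi.single i 1, fun j => ?_, fun j hj => ?_, ?_⟩
      · by_cases h : j = i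
        · subst h; simp
        · simp [h]
      · have : j ≠ i := fun h => hj (h ▸ hi)
        simp [this]
      · rw [Finset.sum_eq_single i]
        · simp
        · intro j _ hj; simp [hj]
        · intro h; exact absurd hi h
    | zero => exact ⟨0, by simp, by simp, by simp⟩
    | add x y _ _ hx hy =>
      obtain ⟨c, hc, hc0, rfl⟩ := hx
      obtain ⟨e, he, he0, rfl⟩ := hy
      refine ⟨c + e, fun i => add_nonneg (hc i) (he i), fun i hi => ?_, ?_⟩
      · simp [hc0 i hi, he0 i hi]
      · simp [add_smul, Finset.sum_add_distrib]
    | smul a x _ hx =>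
      obtain ⟨c, hc, hc0, rfl⟩ := hx
      refine ⟨(a : ℝ) • c, fun i => mul_nonneg a.2 (hc i), fun i hi => ?_, ?_⟩
      · simp [hc0 i hi]
      · rw [Finset.smul_sum]
        refine Finset.sum_congr rfl fun i _ => ?_
        rw [Pi.smul_apply, smul_eq_mul, mul_smul]; rfl
  · rintro ⟨c, hc, -, rfl⟩
    exact Submodule.sum_mem _ fun i hi => PointedCone.smul_mem _ (hc i)
      (Submodule.subset_span ⟨i, hi, rfl⟩)

theorem mem_hull_singleton {x v : V} :
    v ∈ PointedCone.hull ℝ {x} ↔ ∃ c : ℝ, 0 ≤ c ∧ c • x = v := by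
  rw [Submodule.mem_span_singleton]
  exact ⟨fun ⟨a, ha⟩ => ⟨a, a.2, ha⟩, fun ⟨c, hc, h⟩ => ⟨⟨c, hc⟩, h⟩⟩

theorem gen_mem_hull {g : ι → V} {I : Finset ι} {i : ι} (hi : i ∈ I) :
    g i ∈ PointedCone.hull ℝ (g '' (I : Set ι)) :=
  Submodule.subset_span ⟨i, hi, rfl⟩

theorem hull_mono {g : ι → V} {I J : Finset ι} (h : I ⊆ J) :
    PointedCone.hull ℝ (g '' (I : Set ι)) ≤ PointedCone.hull ℝ (g '' (J : Set ι)) :=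
  Submodule.span_mono (Set.image_mono (by exact_mod_cast h))

theorem hull_le_of_gen_mem {g : ι → V} {I : Finset ι} {σ : PointedCone ℝ V}
    (h : ∀ i ∈ I, g i ∈ σ) : PointedCone.hull ℝ (g '' (I : Set ι)) ≤ σ := by
  refine Submodule.span_le.2 ?_
  rintro _ ⟨i, hi, rfl⟩
  exact h i hi

/-- Coefficients with respect to a linearly independent family are unique. -/
theorem coeff_unique {g : ι → V} {I : Finset ι} (hI : LinearIndepOn ℝ g (I : Set ι))
    {c e : ι → ℝ} (h : ∑ i ∈ I, c i • g i = ∑ i ∈ I, e i • g i) : ∀ i ∈ I, c i = e i := by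
  have h0 : ∑ i ∈ I, (c i - e i) • g i = 0 := by
    simp [sub_smul, Finset.sum_sub_distrib, h]
  intro i hi
  have := linearIndepOn_finset_iff.1 hI (fun i => c i - e i) h0 i hi
  linarith

theorem gen_mem_hull_iff [DecidableEq ι] {g : ι → V} {I J : Finset ι}
    (hI : LinearIndepOn ℝ g (I : Set ι))
    (hJ : J ⊆ I) {c : ι → ℝ} (hc : ∀ i ∈ I, 0 ≤ c i) :
    ∑ i ∈ I, c i • g i ∈ PointedCone.hull ℝ (g '' (J : Set ι)) ↔ ∀ i ∈ I, i ∉ J → c i = 0 := by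
  constructor
  · intro h i hi hiJ
    obtain ⟨e, -, he0, he⟩ := mem_hull_image.1 h
    rw [Finset.sum_subset hJ (fun j _ hj => by simp [he0 j hj])] at he
    rw [← coeff_unique hI he i hi, he0 i hiJ]
  · intro h
    rw [← Finset.sum_subset hJ (fun j hj hj' => by simp [h j hj hj'])]
    exact Submodule.sum_mem _ fun i hi => PointedCone.smul_mem _ (hc i (hJ hi)) (gen_mem_hull hi)

theorem mem_of_gen_mem_hull {g : ι → V} {I J : Finset ι} (hI : LinearIndepOn ℝ g (I : Set ι))
    (hJ : J ⊆ I) {i : ι} (hi : i ∈ I) (h : g i ∈ PointedCone.hull ℝ (g '' (J : Set ι))) :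
    i ∈ J := by
  classical
  have h1 : g i = ∑ j ∈ I, (Pi.single i (1 : ℝ) : ι → ℝ) j • g j := by
    rw [Finset.sum_eq_single i (fun j _ hj => by simp [hj]) (fun h => absurd hi h)]; simp
  rw [h1, gen_mem_hull_iff hI hJ] at h
  · by_contra hiJ
    simpa using h i hi hiJ
  · intro j _
    by_cases h : j = i
    · subst h; simp
    · simp [h]

/-- A subcone generated by part of a linearly independent family is a face. -/
theorem isFaceOf_hull {g : ι → V} {I J : Finset ι} (hI : LinearIndepOn ℝ g (I : Set ι))
    (hJ : J ⊆ I) : (PointedCone.hull ℝ (g '' (J : Set ι))).IsFaceOf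
      (PointedCone.hull ℝ (g '' (I : Set ι))) := by
  classical
  refine PointedCone.IsFaceOf.of_mem_of_add_mem_left (hull_mono hJ) ?_
  intro x y hx hy hxy
  obtain ⟨c, hc, -, rfl⟩ := mem_hull_image.1 hx
  obtain ⟨e, he, -, rfl⟩ := mem_hull_image.1 hy
  rw [← Finset.sum_add_distrib] at hxy
  simp only [← add_smul] at hxy
  rw [gen_mem_hull_iff hI hJ (fun i _ => add_nonneg (hc i) (he i))] at hxy
  rw [gen_mem_hull_iff hI hJ (fun i _ => hc i)]
  intro i hi hiJ
  have := hxy i hi hiJ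
  linarith [hc i, he i]

/-- The generators of a face of a polyhedral cone are among those of the cone. -/
theorem eq_hull_of_isFaceOf {g : ι → V} {I : Finset ι} {τ : PointedCone ℝ V}
    (h : τ.IsFaceOf (PointedCone.hull ℝ (g '' (I : Set ι)))) :
    ∃ J ⊆ I, τ = PointedCone.hull ℝ (g '' (J : Set ι)) := by
  classical
  -- If a nonnegative combination lies in the face, so does each generator that occurs in it with a
  -- positive coefficient.
  refine ⟨I.filter (fun i => g i ∈ τ), Finset.filter_subset _ _, le_antisymm ?_ ?_⟩
  · intro v hv
    obtain ⟨c, hc, -, rfl⟩ := mem_hull_image.1 (h.le hv)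
    refine Submodule.sum_mem _ fun i hi => ?_
    rcases (hc i).eq_or_lt with h0 | h0
    · simp [← h0]
    · refine PointedCone.smul_mem _ (hc i) (gen_mem_hull (Finset.mem_filter.2 ⟨hi, ?_⟩))
      rw [← Finset.add_sum_erase _ _ hi] at hv
      refine h.mem_of_smul_add_mem (gen_mem_hull hi) ?_ h0 hv
      exact Submodule.sum_mem _ fun j hj => PointedCone.smul_mem _ (hc j)
        (gen_mem_hull (Finset.mem_of_mem_erase hj))
  · exact hull_le_of_gen_mem fun i hi => (Finset.mem_filter.1 hi).2

theorem salient_hull {g : ι → V} {I : Finset ι} (hI : LinearIndepOn ℝ g (I : Set ι)) :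
    ((PointedCone.hull ℝ (g '' (I : Set ι)) : PointedCone ℝ V) : ConvexCone ℝ V).Salient := by
  intro x hx hx0 hxn
  obtain ⟨c, hc, -, rfl⟩ := mem_hull_image.1 hx
  obtain ⟨e, he, -, h⟩ := mem_hull_image.1 hxn
  apply hx0
  have h0 : ∑ i ∈ I, (c i + e i) • g i = 0 := by
    simp [add_smul, Finset.sum_add_distrib, h]
  refine Finset.sum_eq_zero fun i hi => ?_
  have := linearIndepOn_finset_iff.1 hI (fun i => c i + e i) h0 i hi
  have h1 : c i = 0 := by linarith [hc i, he i]
  simp [h1]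

theorem span_hull (s : Set V) :
    Submodule.span ℝ ((PointedCone.hull ℝ s : PointedCone ℝ V) : Set V) = Submodule.span ℝ s :=
  le_antisymm (Submodule.span_le.2 fun _ hx => PointedCone.hull_le_span ℝ s hx)
    (Submodule.span_mono Submodule.subset_span)

theorem finrank_span_hull {g : ι → V} {I : Finset ι} (hI : LinearIndepOn ℝ g (I : Set ι)) :
    Module.finrank ℝ (Submodule.span ℝ
      ((PointedCone.hull ℝ (g '' (I : Set ι)) : PointedCone ℝ V) : Set V)) = I.card := by
  rw [span_hull]
  have := finrank_span_eq_card (R := ℝ) (b := fun i : I => g i) hI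
  rw [Fintype.card_coe] at this
  rw [← this, Set.image_eq_range]
  rfl

end Cones

/-- Dual vectors of a family of `d` linearly independent vectors of `ℝ^d`. -/
theorem exists_dual {ι : Type*} {d : ℕ} {g : ι → Vec d} {I : Finset ι}
    (hI : LinearIndepOn ℝ g (I : Set ι)) (hc : I.card = d) :
    ∃ u : ι → Vec d, (∀ v, ∑ i ∈ I, (inner ℝ (u i) v : ℝ) • g i = v) ∧
      ∀ (c : ι → ℝ), ∀ i ∈ I, inner ℝ (u i) (∑ j ∈ I, c j • g j) = c i := by
  classical
  have hcard : Fintype.card I = Module.finrank ℝ (Vec d) := by simp [hc]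
  let B : Module.Basis I ℝ (Vec d) :=
    basisOfLinearIndependentOfCardEqFinrank' (fun i : I => g i) hI hcard
  have hB : ∀ i : I, B i = g i := fun i => congrFun (coe_basisOfLinearIndependentOfCardEqFinrank' _ hI hcard) i
  let u : ι → Vec d := fun i => if hi : i ∈ I then
    (InnerProductSpace.toDual ℝ (Vec d)).symm (LinearMap.toContinuousLinearMap (B.coord ⟨i, hi⟩))
    else 0
  have hu : ∀ (i : I) v, (inner ℝ (u i) v : ℝ) = B.repr v i := by
    intro i v
    simp [u]
  have h1 : ∀ v, ∑ i ∈ I, (inner ℝ (u i) v : ℝ) • g i = v := by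
    intro v
    rw [← Finset.sum_coe_sort I (fun i => (inner ℝ (u i) v : ℝ) • g i)]
    simp only [hu, ← hB]
    exact B.sum_repr v
  refine ⟨u, h1, fun c i hi => ?_⟩
  exact coeff_unique hI (c := fun i => inner ℝ (u i) (∑ j ∈ I, c j • g j)) (h1 _) i hi

theorem mem_hull_iff_dual {ι : Type*} {d : ℕ} {g u : ι → Vec d} {I : Finset ι}
    (h1 : ∀ v, ∑ i ∈ I, (inner ℝ (u i) v : ℝ) • g i = v)
    (h2 : ∀ (c : ι → ℝ), ∀ i ∈ I, inner ℝ (u i) (∑ j ∈ I, c j • g j) = c i) (v : Vec d) :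
    v ∈ PointedCone.hull ℝ (g '' (I : Set ι)) ↔ ∀ i ∈ I, 0 ≤ (inner ℝ (u i) v : ℝ) := by
  constructor
  · intro h i hi
    obtain ⟨c, hc, -, rfl⟩ := mem_hull_image.1 h
    rw [h2 c i hi]; exact hc i
  · intro h
    rw [← h1 v]
    exact Submodule.sum_mem _ fun i hi => PointedCone.smul_mem _ (h i hi) (gen_mem_hull hi)

theorem isClosed_hull {ι : Type*} {d : ℕ} {g : ι → Vec d} {I : Finset ι}
    (hI : LinearIndepOn ℝ g (I : Set ι)) (hc : I.card = d) :
    IsClosed ((PointedCone.hull ℝ (g '' (I : Set ι)) : PointedCone ℝ (Vec d)) : Set (Vec d)) := by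
  obtain ⟨u, h1, h2⟩ := exists_dual hI hc
  have : ((PointedCone.hull ℝ (g '' (I : Set ι)) : PointedCone ℝ (Vec d)) : Set (Vec d)) =
      ⋂ i ∈ I, {v | 0 ≤ (inner ℝ (u i) v : ℝ)} := by
    ext v
    simp only [SetLike.mem_coe, mem_hull_iff_dual h1 h2, Set.mem_iInter, Set.mem_ofPred_eq]
  rw [this]
  exact isClosed_biInter fun i _ => isClosed_le continuous_const (by fun_prop)

/-- A point in the interior of a full-dimensional simplicial cone, moved a little in the direction
of any vector, stays in the cone. -/
theorem exists_smul_add_mem_hull {ι : Type*} {d : ℕ} {g : ι → Vec d} {I : Finset ι}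
    (hI : LinearIndepOn ℝ g (I : Set ι)) (hc : I.card = d) (v : Vec d) :
    ∃ N : ℝ, 0 < N ∧ N • (∑ i ∈ I, g i) + v ∈ PointedCone.hull ℝ (g '' (I : Set ι)) := by
  obtain ⟨u, h1, h2⟩ := exists_dual hI hc
  -- The `i`-th coordinate of the vector is `N + ⟪u i, v⟫`, which this `N` keeps at least `1`.
  refine ⟨1 + ∑ i ∈ I, |(inner ℝ (u i) v : ℝ)|, by positivity, ?_⟩
  rw [mem_hull_iff_dual h1 h2]
  intro i hi
  have h3 : (inner ℝ (u i) (∑ i ∈ I, g i) : ℝ) = 1 := by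
    simpa using h2 (fun _ => 1) i hi
  rw [inner_add_right, inner_smul_right, h3]
  have := Finset.single_le_sum (f := fun i => |(inner ℝ (u i) v : ℝ)|)
    (fun i _ => abs_nonneg _) hi
  have := neg_abs_le (inner ℝ (u i) v : ℝ)
  linarith


/-! ### Combinatorics of admissible simplicial fans. -/

section Admissible

variable {d m : ℕ} {D : Set (Finset (Idx d m))} {h : Calibration d m}

/-- The cone `Cone(h(e_i), i ∈ I)`. -/
noncomputable abbrev coneOf (h : Calibration d m) (I : Finset (Idx d m)) : PointedCone ℝ (Vec d) :=
  PointedCone.hull ℝ (gen h '' (I : Set (Idx d m)))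

theorem coneOf_mem_fanOf {I : Finset (Idx d m)} (hI : I ∈ D) : coneOf h I ∈ fanOf D h :=
  ⟨I, hI, rfl⟩

theorem coneOf_singleton (i : Idx d m) : coneOf h {i} = PointedCone.hull ℝ {gen h i} := by
  simp [coneOf]

theorem coneOf_empty : coneOf h ∅ = ⊥ := by
  simp [coneOf]

namespace IsAdmissible

theorem mem_rayIdx (hD : IsAdmissible D h) {I : Finset (Idx d m)} (hI : I ∈ D) {i : Idx d m}
    (hi : i ∈ I) : i ∈ rayIdx D := by
  rw [← hD.2] at hI
  obtain ⟨σ, -, hσ⟩ := hI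
  exact ((hσ i).1 hi).1

/-- The combinatorial type only says that `I` records the generators lying on some cone `σ` of the
fan; but `σ` contains `coneOf h I`, which suffices. -/
theorem mem_of_gen_mem (hD : IsAdmissible D h) {I : Finset (Idx d m)} (hI : I ∈ D) {i : Idx d m}
    (hi : i ∈ rayIdx D) (hg : gen h i ∈ coneOf h I) : i ∈ I := by
  have hI' := hI
  rw [← hD.2] at hI'
  obtain ⟨σ, ⟨J, hJ, rfl⟩, hσ⟩ := hI'
  refine (hσ i).2 ⟨hi, hull_le_of_gen_mem (fun j hj => ((hσ j).1 hj).2) hg⟩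

/-- The intersection is a face, hence the cone of some `K ∈ D`, and each generator of `K` lies in
both cones, so `K ⊆ I ∩ J`. -/
theorem inf_eq [DecidableEq (Idx d m)] (hD : IsAdmissible D h) {I J : Finset (Idx d m)}
    (hI : I ∈ D) (hJ : J ∈ D) : coneOf h I ⊓ coneOf h J = coneOf h (I ∩ J) := by
  have hF := hD.1.isFan
  obtain ⟨K, hK, hIJ⟩ := hF.face_mem _ (coneOf_mem_fanOf hI) _
    (hF.inter_face _ (coneOf_mem_fanOf hI) _ (coneOf_mem_fanOf hJ))
  refine le_antisymm ?_ (le_inf (hull_mono Finset.inter_subset_left)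
    (hull_mono Finset.inter_subset_right))
  rw [hIJ]
  refine hull_mono fun k hk => ?_
  have hk' : gen h k ∈ coneOf h I ⊓ coneOf h J := by
    rw [hIJ]; exact gen_mem_hull hk
  exact Finset.mem_inter.2 ⟨hD.mem_of_gen_mem hI (hD.mem_rayIdx hK hk) hk'.1,
    hD.mem_of_gen_mem hJ (hD.mem_rayIdx hK hk) hk'.2⟩

theorem isFaceOf (hD : IsAdmissible D h) {I : Finset (Idx d m)} (hI : I ∈ D)
    {τ : PointedCone ℝ (Vec d)} (hτ : τ ∈ fanOf D h) (hle : τ ≤ coneOf h I) :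
    τ.IsFaceOf (coneOf h I) := by
  have := hD.1.isFan.inter_face _ (coneOf_mem_fanOf hI) _ hτ
  rwa [inf_eq_right.2 hle] at this

theorem empty_mem (hD : IsAdmissible D h) : ∅ ∈ D := by
  rw [← hD.2]
  refine ⟨⊥, hD.1.isFan.bot_mem, fun i => ?_⟩
  simp only [Finset.notMem_empty, false_iff, not_and]
  intro hi h0
  have h1 := ((hD.1.rays _).2 ⟨i, hi, rfl⟩).2
  rw [Submodule.mem_bot] at h0
  rw [span_hull, h0] at h1
  rw [Submodule.span_zero_singleton, finrank_bot] at h1; exact zero_ne_one h1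

theorem gen_ne_zero (hD : IsAdmissible D h) {i : Idx d m} (hi : i ∈ rayIdx D) : gen h i ≠ 0 := by
  intro h0
  have h1 := ((hD.1.rays _).2 ⟨i, hi, rfl⟩).2
  rw [span_hull, h0] at h1
  rw [Submodule.span_zero_singleton, finrank_bot] at h1; exact zero_ne_one h1

theorem ray_le {I : Finset (Idx d m)} {i : Idx d m} (hi : i ∈ I) :
    PointedCone.hull ℝ {gen h i} ≤ coneOf h I :=
  Submodule.span_mono (by rintro _ rfl; exact ⟨i, hi, rfl⟩)

/-- The cone is spanned by a linearly independent set `s`. The ray of each `h(e_i)` is a face, so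
`h(e_i)` is a positive multiple of an element of `s`; different indices give different elements,
since a generator on another's ray would have the same index. -/
theorem linearIndepOn_of_isSimplicial (hD : IsAdmissible D h) {I : Finset (Idx d m)} (hI : I ∈ D)
    (hs : (coneOf h I).IsSimplicial) : LinearIndepOn ℝ (gen h) (I : Set (Idx d m)) := by
  classical
  obtain ⟨s, hfin, hli, hsI⟩ := hs
  have key : ∀ i : I, ∃ x : s, ∃ t : ℝˣ, 0 < (t : ℝ) ∧ gen h i = (t : ℝ) • (x : Vec d) := by
    rintro ⟨i, hi⟩
    have hir := hD.mem_rayIdx hI hi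
    have hface := hD.isFaceOf hI ((hD.1.rays _).2 ⟨i, hir, rfl⟩).1 (ray_le hi)
    have hgi : gen h i ∈ PointedCone.hull ℝ ((id : Vec d → Vec d) '' (hfin.toFinset : Set (Vec d))) := by
      simp only [Set.image_id, Set.Finite.coe_toFinset, hsI]
      exact gen_mem_hull hi
    obtain ⟨c, hc, hc0, hsum⟩ := mem_hull_image.1 hgi
    have hex : ∃ x ∈ hfin.toFinset, 0 < c x := by
      by_contra! hcon
      apply hD.gen_ne_zero hir
      rw [← hsum]
      exact Finset.sum_eq_zero fun x hx => by
        rw [le_antisymm (hcon x hx) (hc x), zero_smul]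
    obtain ⟨x, hx, hcx⟩ := hex
    have hmem : ∀ y ∈ hfin.toFinset, y ∈ coneOf h I := fun y hy => by
      rw [← hsI]; exact Submodule.subset_span (hfin.mem_toFinset.1 hy)
    have hxr : x ∈ PointedCone.hull ℝ {gen h i} := by
      refine hface.mem_of_smul_add_mem (y := ∑ y ∈ hfin.toFinset.erase x, c y • y) (hmem x hx)
        (Submodule.sum_mem _ fun y hy => PointedCone.smul_mem _ (hc y)
          (hmem y (Finset.mem_of_mem_erase hy))) hcx ?_
      have := Finset.add_sum_erase _ (fun y => c y • (id y)) hx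
      simp only [id] at this hsum
      rw [this, hsum]
      exact Submodule.mem_span_singleton_self _
    obtain ⟨a, ha, hax⟩ := mem_hull_singleton.1 hxr
    have hxs := hfin.mem_toFinset.1 hx
    have hx0 : x ≠ 0 := fun h0 => (hli.ne_zero (i := x) hxs) h0
    have ha0 : a ≠ 0 := by rintro rfl; exact hx0 (by rw [← hax, zero_smul])
    refine ⟨⟨x, hxs⟩, (Units.mk0 a ha0)⁻¹, ?_, ?_⟩
    · simpa using lt_of_le_of_ne ha ha0.symm
    · simp [← hax, smul_smul, ha0]
  choose x t ht hxt using key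
  have hinj : Function.Injective x := by
    intro i j hij
    have hi := hD.mem_rayIdx hI i.2
    have hj : ({(j : Idx d m)} : Finset (Idx d m)) ∈ D := hD.mem_rayIdx hI j.2
    have : gen h i ∈ coneOf h {(j : Idx d m)} := by
      rw [coneOf_singleton, mem_hull_singleton]
      refine ⟨t i * (t j : ℝ)⁻¹, by have := ht i; have := ht j; positivity, ?_⟩
      rw [hxt i, hxt j, hij, smul_smul, mul_assoc, inv_mul_cancel₀ (ht j).ne', mul_one]
    exact Subtype.ext (Finset.mem_singleton.1 (hD.mem_of_gen_mem hj hi this))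
  have h1 : LinearIndependent ℝ (fun i : I => ((x i : s) : Vec d)) := hli.comp x hinj
  have h2 := h1.units_smul t
  have h3 : (t • fun i : I => ((x i : s) : Vec d)) = fun i : I => gen h i := by
    funext i
    simp only [Pi.smul_apply', hxt i]
    rfl
  rw [h3] at h2
  exact h2

/-- The face spanned by `J` is the cone of some `K ∈ D`, and both `J` and `K` are the set of indices
whose generators lie on it. -/
theorem mem_of_subset (hD : IsAdmissible D h) {I J : Finset (Idx d m)} (hI : I ∈ D)
    (hli : LinearIndepOn ℝ (gen h) (I : Set (Idx d m))) (hJ : J ⊆ I) : J ∈ D := by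
  obtain ⟨K, hK, hKJ⟩ := hD.1.isFan.face_mem _ (coneOf_mem_fanOf hI) _ (isFaceOf_hull hli hJ)
  have hKJ' : coneOf h J = coneOf h K := hKJ
  have : J = K := by
    ext i
    constructor
    · intro hi
      refine hD.mem_of_gen_mem hK (hD.mem_rayIdx hI (hJ hi)) ?_
      rw [← hKJ']; exact gen_mem_hull hi
    · intro hi
      have hg : gen h i ∈ coneOf h J := by rw [hKJ']; exact gen_mem_hull hi
      exact mem_of_gen_mem_hull hli hJ
        (hD.mem_of_gen_mem hI (hD.mem_rayIdx hK hi) (hull_mono hJ hg)) hg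
  rwa [this]

/-- If `D` is a simplicial complex, the cones of every `D`-admissible fan are simplicial. -/
theorem linearIndepOn (hD : IsAdmissible D h) (hdown : ∀ I ∈ D, ∀ J ⊆ I, J ∈ D)
    {I : Finset (Idx d m)} (hI : I ∈ D) : LinearIndepOn ℝ (gen h) (I : Set (Idx d m)) := by
  classical
  -- A linear relation has no negative coefficient: separating signs writes one vector both as a
  -- positive combination over `P` and as a combination over `N`. As `P ∈ D` spans a face, a
  -- generator with negative coefficient would lie in that face, forcing its index into `P`. Applied
  -- to `a` and `-a`, this gives independence.
  have key : ∀ a : Idx d m → ℝ, ∑ i ∈ I, a i • gen h i = 0 → ∀ i ∈ I, 0 ≤ a i := by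
    intro a ha i hi
    by_contra! hneg
    have hP : I.filter (fun i => 0 < a i) ∈ D := hdown I hI _ (Finset.filter_subset _ _)
    set P := I.filter (fun i => 0 < a i) with hPdef
    have hface := hD.isFaceOf hI (coneOf_mem_fanOf hP) (hull_mono (Finset.filter_subset _ _))
    set N := I.filter (fun i => ¬ 0 < a i) with hNdef
    have hsplit : ∑ i ∈ P, a i • gen h i = ∑ i ∈ N, (-a i) • gen h i := by
      have := Finset.sum_filter_add_sum_filter_not I (fun i => 0 < a i) (fun i => a i • gen h i)
      rw [ha] at this
      simp only [neg_smul, Finset.sum_neg_distrib]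
      exact eq_neg_of_add_eq_zero_left this
    have hv : ∑ i ∈ N, (-a i) • gen h i ∈ coneOf h P := by
      rw [← hsplit]
      exact Submodule.sum_mem _ fun j hj => PointedCone.smul_mem _
        (Finset.mem_filter.1 hj).2.le (gen_mem_hull hj)
    have hiN : i ∈ N := Finset.mem_filter.2 ⟨hi, hneg.le.not_gt⟩
    rw [← Finset.add_sum_erase _ _ hiN] at hv
    have hgi := hface.mem_of_smul_add_mem (gen_mem_hull hi)
      (Submodule.sum_mem _ fun j hj => PointedCone.smul_mem _ (neg_nonneg.2 (not_lt.1
        (Finset.mem_filter.1 (Finset.mem_of_mem_erase hj)).2))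
        (gen_mem_hull (Finset.mem_filter.1 (Finset.mem_of_mem_erase hj)).1)) (neg_pos.2 hneg) hv
    have := hD.mem_of_gen_mem hP (hD.mem_rayIdx hI hi) hgi
    exact hneg.le.not_gt (Finset.mem_filter.1 this).2
  rw [linearIndepOn_finset_iff]
  intro a ha i hi
  refine le_antisymm ?_ (key a ha i hi)
  have := key (-a) (by simpa using ha) i hi
  simpa using this

/-- If the sum of the generators of a simplicial cone lies in another cone of the fan, then the
first cone is a face of the second one. -/
theorem subset_of_sum_mem (hD : IsAdmissible D h) {I J : Finset (Idx d m)} (hI : I ∈ D)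
    (hJ : J ∈ D) (hli : LinearIndepOn ℝ (gen h) (J : Set (Idx d m)))
    (hmem : ∑ j ∈ J, gen h j ∈ coneOf h I) : J ⊆ I := by
  classical
  have h1 : ∑ j ∈ J, gen h j ∈ coneOf h J :=
    Submodule.sum_mem _ fun j hj => gen_mem_hull hj
  have h2 : ∑ j ∈ J, (fun _ => (1 : ℝ)) j • gen h j ∈ coneOf h (J ∩ I) := by
    simp only [one_smul]
    rw [← hD.inf_eq hJ hI]; exact ⟨h1, hmem⟩
  rw [gen_mem_hull_iff hli Finset.inter_subset_left (fun _ _ => zero_le_one)] at h2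
  intro j hj
  by_contra hjI
  exact one_ne_zero (h2 j hj fun h => hjI (Finset.mem_inter.1 h).2)

end IsAdmissible

/-- Points of a complete simplicial fan lie in full-dimensional cones. -/
theorem exists_full_cone (hcomp : IsComplete (fanOf D h))
    (hli : ∀ I ∈ D, LinearIndepOn ℝ (gen h) (I : Set (Idx d m))) (v : Vec d) :
    ∃ I ∈ D, I.card = d ∧ v ∈ coneOf h I := by
  classical
  let F : Set (Vec d) := ⋃ I ∈ {I | I ∈ D ∧ I.card = d}, (coneOf h I : Set (Vec d))
  have hF : IsClosed F := (Set.toFinite _).isClosed_biUnion fun I hI =>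
    isClosed_hull (hli I hI.1) hI.2
  -- The lower-dimensional cones lie in proper subspaces, so the open complement of `F` has measure
  -- zero and is empty.
  have hsub : Fᶜ ⊆ ⋃ I ∈ {I | I ∈ D ∧ I.card ≠ d},
      (Submodule.span ℝ (gen h '' (I : Set (Idx d m))) : Set (Vec d)) := by
    intro x hx
    obtain ⟨σ, ⟨I, hI, rfl⟩, hxI⟩ := hcomp x
    refine Set.mem_biUnion (x := I) ⟨hI, fun hc => hx (Set.mem_biUnion (x := I) ⟨hI, hc⟩ hxI)⟩ ?_
    exact PointedCone.hull_le_span ℝ _ hxI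
  have hnull : MeasureTheory.volume Fᶜ = 0 := by
    refine MeasureTheory.measure_mono_null hsub ?_
    rw [MeasureTheory.measure_biUnion_null_iff (Set.to_countable _)]
    rintro I ⟨hI, hc⟩
    refine MeasureTheory.Measure.addHaar_submodule _ _ fun htop => hc ?_
    rw [← finrank_span_hull (hli I hI), span_hull, htop]
    simp
  have hempty := (hF.isOpen_compl.measure_eq_zero_iff _).1 hnull
  have hv : v ∈ F := by
    by_contra hv
    have : v ∈ Fᶜ := hv
    rw [hempty] at this
    exact this
  obtain ⟨I, hI, hvI⟩ := Set.mem_iUnion₂.1 hv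
  exact ⟨I, hI.1, hI.2, hvI⟩

/-- The combinatorial properties of the type of a complete simplicial fan in `ℝ^d`: it is a pure
simplicial complex, and every codimension `1` simplex lies on both sides of it. -/
structure IsThinComplex (D : Set (Finset (Idx d m))) : Prop where
  empty_mem : ∅ ∈ D
  down : ∀ I ∈ D, ∀ J ⊆ I, J ∈ D
  pure : ∀ J ∈ D, ∃ I ∈ D, I.card = d ∧ J ⊆ I
  thin : ∀ I ∈ D, I.card = d → ∀ i ∈ I, ∃ J ∈ D, J.card = d ∧ i ∉ J ∧ ∀ j ∈ I, j ≠ i → j ∈ J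

theorem IsAdmissible.isThinComplex (hD : IsAdmissible D h)
    (hli : ∀ I ∈ D, LinearIndepOn ℝ (gen h) (I : Set (Idx d m)))
    (hcomp : IsComplete (fanOf D h)) : IsThinComplex D := by
  classical
  have hpt := fun J hJ I hI => hD.subset_of_sum_mem (I := I) (J := J) hI hJ (hli J hJ)
  have hdown : ∀ I ∈ D, ∀ J ⊆ I, J ∈ D := fun I hI J hJ => hD.mem_of_subset hI (hli I hI) hJ
  refine ⟨hD.empty_mem, hdown, ?_, ?_⟩
  · intro J hJ
    obtain ⟨I, hI, hc, hv⟩ := exists_full_cone hcomp hli (∑ j ∈ J, gen h j)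
    exact ⟨I, hI, hc, hpt J hJ I hI hv⟩
  · intro I hI hc i hi
    set w := ∑ j ∈ I.erase i, gen h j with hw
    -- some full cone contains `M w - g_i` for arbitrarily large `M`
    have hchoice : ∀ M : ℕ, ∃ J : {J : Finset (Idx d m) // J ∈ D ∧ J.card = d},
        (M : ℝ) • w - gen h i ∈ coneOf h J := by
      intro M
      obtain ⟨J, hJ, hcJ, hv⟩ := exists_full_cone hcomp hli ((M : ℝ) • w - gen h i)
      exact ⟨⟨J, hJ, hcJ⟩, hv⟩
    choose f hf using hchoice
    -- There are finitely many full cones, so one of them serves infinitely many `M`; letting `M`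
    -- grow puts `w` itself in that cone.
    obtain ⟨⟨J, hJ, hcJ⟩, hinf⟩ := Finite.exists_infinite_fiber f
    have hinf' : (f ⁻¹' {⟨J, hJ, hcJ⟩}).Infinite := Set.infinite_coe_iff.1 hinf
    have hmem : ∀ M ∈ f ⁻¹' {⟨J, hJ, hcJ⟩}, (M : ℝ) • w - gen h i ∈ coneOf h J := by
      intro M hM
      have := hf M
      rwa [Set.mem_singleton_iff.1 hM] at this
    obtain ⟨u, h1, h2⟩ := exists_dual (hli J hJ) hcJ
    have hwJ : w ∈ coneOf h J := by
      rw [mem_hull_iff_dual h1 h2]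
      intro j hj
      by_contra! hneg
      obtain ⟨M, hM, hlt⟩ := hinf'.exists_gt
        ⌈(-(inner ℝ (u j) (gen h i) : ℝ)) / (-(inner ℝ (u j) w : ℝ))⌉₊
      have h3 := (mem_hull_iff_dual h1 h2 _).1 (hmem M hM) j hj
      rw [inner_sub_right, inner_smul_right] at h3
      have h4 := (Nat.le_ceil _).trans_lt (Nat.cast_lt (α := ℝ).2 hlt)
      rw [div_lt_iff₀ (neg_pos.2 hneg)] at h4
      linarith
    have hsub := hpt _ (hdown I hI _ (Finset.erase_subset i I)) J hJ hwJ
    -- If `i ∈ J`, then `J = I`; but `M w - g_i` has coordinate `-1` at `i`.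
    refine ⟨J, hJ, hcJ, fun hiJ => ?_, fun j hj hji => hsub (Finset.mem_erase.2 ⟨hji, hj⟩)⟩
    have hIJ : I = J := Finset.eq_of_subset_of_card_le (fun j hj => by
      by_cases hji : j = i
      · rwa [hji]
      · exact hsub (Finset.mem_erase.2 ⟨hji, hj⟩)) (by rw [hc, hcJ])
    subst hIJ
    obtain ⟨M, hM⟩ := hinf'.nonempty
    have h3 := (mem_hull_iff_dual h1 h2 _).1 (hmem M hM) i hi
    have h4 : (M : ℝ) • w - gen h i = ∑ j ∈ I, (if j = i then (-1 : ℝ) else M) • gen h j := by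
      rw [← Finset.add_sum_erase _ _ hi, if_pos rfl, hw, Finset.smul_sum, neg_smul, one_smul,
        sub_eq_neg_add]
      congr 1
      exact Finset.sum_congr rfl fun j hj => by rw [if_neg (Finset.ne_of_mem_erase hj)]
    rw [h4, h2 _ i hi, if_pos rfl] at h3
    linarith

theorem IsSimplicialPolytopalType.isThinComplex (hD : IsSimplicialPolytopalType D) :
    IsThinComplex D := by
  obtain ⟨h, hadm, hpoly, hsimp⟩ := hD
  exact hadm.isThinComplex (fun I hI => hadm.linearIndepOn_of_isSimplicial hI
    (hsimp _ (coneOf_mem_fanOf hI))) hpoly.1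

end Admissible


/-! ### From vertices with positive slacks back to a polytopal fan. -/

section VertexSystem

variable {d m : ℕ} {D : Set (Finset (Idx d m))} {h : Calibration d m} {b : Idx d m → ℝ}
  {x : Finset (Idx d m) → Vec d}

/-- For each maximal `I ∈ D`, a point `x I` of `P_b` at which the inequalities indexed by `I` are
equalities. -/
structure IsVertexSystem (D : Set (Finset (Idx d m))) (h : Calibration d m) (b : Idx d m → ℝ)
    (x : Finset (Idx d m) → Vec d) : Prop where
  eq : ∀ I ∈ D, I.card = d → ∀ i ∈ I, (inner ℝ (x I) (gen h i) : ℝ) = -b i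
  le : ∀ I ∈ D, I.card = d → ∀ i, -b i ≤ (inner ℝ (x I) (gen h i) : ℝ)

/-- A vertex system is strict if the inequalities not indexed by `I` are strict at `x I`. -/
structure IsStrictVertexSystem (D : Set (Finset (Idx d m))) (h : Calibration d m)
    (b : Idx d m → ℝ) (x : Finset (Idx d m) → Vec d) : Prop extends IsVertexSystem D h b x where
  lt : ∀ I ∈ D, I.card = d → ∀ i ∉ I, -b i < (inner ℝ (x I) (gen h i) : ℝ)

namespace IsVertexSystem

/-- On a combination of the generators of `J`, the forms `x I` and `x J` differ by the coefficients
times the slacks at `x I`. All comparisons of vertices rest on this. -/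
theorem sum_eq (hx : IsVertexSystem D h b x) {J : Finset (Idx d m)} (hJ : J ∈ D)
    (hJc : J.card = d) (I : Finset (Idx d m)) (c : Idx d m → ℝ) :
    (inner ℝ (x I) (∑ j ∈ J, c j • gen h j) : ℝ) - inner ℝ (x J) (∑ j ∈ J, c j • gen h j) =
      ∑ j ∈ J, c j * (inner ℝ (x I) (gen h j) + b j) := by
  simp only [inner_sum, inner_smul_right]
  rw [← Finset.sum_sub_distrib]
  refine Finset.sum_congr rfl fun j hj => ?_
  rw [hx.eq J hJ hJc j hj]; ring

theorem inner_le (hx : IsVertexSystem D h b x) {I J : Finset (Idx d m)} (hI : I ∈ D)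
    (hIc : I.card = d) (hJ : J ∈ D) (hJc : J.card = d) {v : Vec d} (hv : v ∈ coneOf h J) :
    (inner ℝ (x J) v : ℝ) ≤ inner ℝ (x I) v := by
  obtain ⟨c, hc, -, rfl⟩ := mem_hull_image.1 hv
  rw [← sub_nonneg, hx.sum_eq hJ hJc]
  exact Finset.sum_nonneg fun j _ => mul_nonneg (hc j) (by linarith [hx.le I hI hIc j])

/-- The support function of the polyhedron `P_b`. -/
theorem exists_supportFunction (hT : IsThinComplex D) (hx : IsVertexSystem D h b x)
    (hcov : ∀ v, ∃ I ∈ D, I.card = d ∧ v ∈ coneOf h I) :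
    ∃ φ, IsConvexSupportFunction (fanOf D h) φ ∧
      (∀ I ∈ D, I.card = d → ∀ v ∈ coneOf h I, φ v = inner ℝ (x I) v) ∧
      ∀ I ∈ D, I.card = d → ∀ v, φ v ≤ inner ℝ (x I) v := by
  choose I hI hIc hv using hcov
  have h1 : ∀ J ∈ D, J.card = d → ∀ v, (inner ℝ (x (I v)) v : ℝ) ≤ inner ℝ (x J) v :=
    fun J hJ hJc v => hx.inner_le hJ hJc (hI v) (hIc v) (hv v)
  have h2 : ∀ J ∈ D, J.card = d → ∀ v ∈ coneOf h J, (inner ℝ (x (I v)) v : ℝ) = inner ℝ (x J) v :=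
    fun J hJ hJc v hvJ => (h1 J hJ hJc v).antisymm (hx.inner_le (hI v) (hIc v) hJ hJc hvJ)
  -- By `h1` this is the minimum of the forms `x J` over the facets `J`, hence concave; by `h2` the
  -- chosen cone is immaterial.
  refine ⟨fun v => inner ℝ (x (I v)) v, ⟨?_, convex_univ, ?_⟩, h2, h1⟩
  · rintro _ ⟨J, hJ, rfl⟩
    obtain ⟨K, hK, hKc, hJK⟩ := hT.pure J hJ
    exact ⟨innerₛₗ ℝ (x K), fun v hvJ => h2 K hK hKc v (hull_mono hJK hvJ)⟩
  · intro v _ w _ s t hs ht _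
    simp only [inner_add_right, inner_smul_right, smul_eq_mul]
    gcongr
    · exact h1 _ (hI _) (hIc _) v
    · exact h1 _ (hI _) (hIc _) w

end IsVertexSystem

namespace IsStrictVertexSystem

/-- The simplex algorithm: every vector lies in the cone of the vertices at which the
corresponding linear form is minimal. -/
theorem exists_full_cone (hT : IsThinComplex D)
    (hli : ∀ I ∈ D, I.card = d → LinearIndepOn ℝ (gen h) (I : Set (Idx d m)))
    (hx : IsStrictVertexSystem D h b x) (v : Vec d) :
    ∃ I ∈ D, I.card = d ∧ v ∈ coneOf h I := by
  have hne : {I | I ∈ D ∧ I.card = d}.Nonempty := by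
    obtain ⟨I, hI, hc, -⟩ := hT.pure ∅ hT.empty_mem
    exact ⟨I, hI, hc⟩
  obtain ⟨I, ⟨hI, hc⟩, hmin⟩ := (Set.toFinite {I | I ∈ D ∧ I.card = d}).exists_minimalFor
    (fun I => (inner ℝ (x I) v : ℝ)) _ hne
  have hmin' : ∀ J ∈ D, J.card = d → (inner ℝ (x I) v : ℝ) ≤ inner ℝ (x J) v := fun J hJ hJc => by
    by_contra! hlt
    exact (hmin ⟨hJ, hJc⟩ hlt.le).not_gt hlt
  refine ⟨I, hI, hc, ?_⟩
  obtain ⟨u, h1, h2⟩ := exists_dual (hli I hI hc) hc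
  rw [mem_hull_iff_dual h1 h2]
  intro i hi
  by_contra! hneg
  -- Passing to the neighbour `J` across the wall opposite `i` leaves only the `i`-th term: a
  -- negative coordinate times a positive slack. The value at `v` would drop below the minimum.
  obtain ⟨J, hJ, hJc, hiJ, hsub⟩ := hT.thin I hI hc i hi
  have h3 := hx.sum_eq hI hc J (fun i => inner ℝ (u i) v)
  rw [h1 v, Finset.sum_eq_single_of_mem i hi] at h3
  · have h4 := mul_neg_of_neg_of_pos hneg
      (show 0 < (inner ℝ (x J) (gen h i) : ℝ) + b i by linarith [hx.lt J hJ hJc i hiJ])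
    linarith [hmin' J hJ hJc]
  · intro j hj hji
    rw [hx.eq J hJ hJc j (hsub j hj hji)]; ring

/-- Equality makes a sum of nonnegative terms vanish, and for `j ∉ I` the slack factor is positive.
-/
theorem coeff_eq_zero (hx : IsStrictVertexSystem D h b x) {I J : Finset (Idx d m)} (hI : I ∈ D)
    (hIc : I.card = d) (hJ : J ∈ D) (hJc : J.card = d) {c : Idx d m → ℝ} (hc : ∀ j, 0 ≤ c j)
    (heq : (inner ℝ (x I) (∑ j ∈ J, c j • gen h j) : ℝ) = inner ℝ (x J) (∑ j ∈ J, c j • gen h j)) :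
    ∀ j ∈ J, j ∉ I → c j = 0 := by
  have h1 := hx.sum_eq hJ hJc I c
  rw [heq, sub_self, eq_comm, Finset.sum_eq_zero_iff_of_nonneg
    (fun j _ => mul_nonneg (hc j) (by linarith [hx.le I hI hIc j]))] at h1
  intro j hj hjI
  exact (mul_eq_zero.1 (h1 j hj)).resolve_right (by linarith [hx.lt I hI hIc j hjI])

theorem mem_of_inner_eq (hx : IsStrictVertexSystem D h b x) {I J : Finset (Idx d m)} (hI : I ∈ D)
    (hIc : I.card = d) (hJ : J ∈ D) (hJc : J.card = d) {v : Vec d} (hv : v ∈ coneOf h J)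
    (heq : (inner ℝ (x I) v : ℝ) = inner ℝ (x J) v) : v ∈ coneOf h I := by
  obtain ⟨c, hc, -, rfl⟩ := mem_hull_image.1 hv
  refine Submodule.sum_mem _ fun j hj => ?_
  by_cases hjI : j ∈ I
  · exact PointedCone.smul_mem _ (hc j) (gen_mem_hull hjI)
  · rw [hx.coeff_eq_zero hI hIc hJ hJc hc heq j hj hjI, zero_smul]
    exact Submodule.zero_mem _

/-- For facets `I' ⊇ I` and `J' ⊇ J`, the two linear forms agree on `v`. Hence an expression of `v`
over `J` has no coefficient outside `I'`, and uniqueness of coordinates over `I'` removes those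
outside `I`. -/
theorem inf_eq [DecidableEq (Idx d m)] (hT : IsThinComplex D)
    (hli : ∀ I ∈ D, I.card = d → LinearIndepOn ℝ (gen h) (I : Set (Idx d m)))
    (hx : IsStrictVertexSystem D h b x) {I J : Finset (Idx d m)}
    (hI : I ∈ D) (hJ : J ∈ D) : coneOf h I ⊓ coneOf h J = coneOf h (I ∩ J) := by
  refine le_antisymm ?_ (le_inf (hull_mono Finset.inter_subset_left)
    (hull_mono Finset.inter_subset_right))
  rintro v ⟨hvI, hvJ⟩
  obtain ⟨I', hI', hI'c, hII'⟩ := hT.pure I hI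
  obtain ⟨J', hJ', hJ'c, hJJ'⟩ := hT.pure J hJ
  have heq : (inner ℝ (x I') v : ℝ) = inner ℝ (x J') v :=
    (hx.inner_le hJ' hJ'c hI' hI'c (hull_mono hII' hvI)).antisymm
      (hx.inner_le hI' hI'c hJ' hJ'c (hull_mono hJJ' hvJ))
  obtain ⟨c, hc, hc0, hcv⟩ := mem_hull_image.1 hvJ
  rw [Finset.sum_subset hJJ' (fun j _ hj => by simp [hc0 j hj])] at hcv
  have h1 := hx.coeff_eq_zero hI' hI'c hJ' hJ'c hc (by rw [hcv]; exact heq)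
  have h1' : ∀ j, j ∉ I' → c j = 0 := fun j hj => by
    by_cases hjJ : j ∈ J
    · exact h1 j (hJJ' hjJ) hj
    · exact hc0 j hjJ
  have hcv' : ∑ j ∈ I', c j • gen h j = v := by
    rw [← hcv]
    trans ∑ j ∈ I' ∩ J', c j • gen h j
    · exact (Finset.sum_subset Finset.inter_subset_left fun j hj hj' => by
        rw [hc0 j fun hjJ => hj' (Finset.mem_inter.2 ⟨hj, hJJ' hjJ⟩), zero_smul]).symm
    · exact Finset.sum_subset Finset.inter_subset_right fun j hj hj' => by
        rw [h1' j fun hjI => hj' (Finset.mem_inter.2 ⟨hjI, hj⟩), zero_smul]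
  rw [← hcv'] at hvI ⊢
  rw [SetLike.mem_coe, gen_mem_hull_iff (hli I' hI' hI'c) hII' (fun j _ => hc j)] at hvI
  rw [gen_mem_hull_iff (hli I' hI' hI'c) (Finset.inter_subset_left.trans hII') (fun j _ => hc j)]
  intro j hj hjIJ
  by_cases hjI : j ∈ I
  · exact hc0 j fun hjJ => hjIJ (Finset.mem_inter.2 ⟨hjI, hjJ⟩)
  · exact hvI j hj hjI

theorem isFan (hT : IsThinComplex D)
    (hli : ∀ I ∈ D, I.card = d → LinearIndepOn ℝ (gen h) (I : Set (Idx d m)))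
    (hx : IsStrictVertexSystem D h b x) : IsFan (fanOf D h) := by
  classical
  have hli' : ∀ I ∈ D, LinearIndepOn ℝ (gen h) (I : Set (Idx d m)) := fun I hI => by
    obtain ⟨J, hJ, hJc, hIJ⟩ := hT.pure I hI
    exact (hli J hJ hJc).mono (by exact_mod_cast hIJ)
  refine ⟨?_, ⟨∅, hT.empty_mem, coneOf_empty.symm⟩, ?_, ?_, ?_, ?_⟩
  · refine (Set.toFinite (coneOf h '' D)).subset ?_
    rintro _ ⟨I, hI, rfl⟩
    exact ⟨I, hI, rfl⟩
  · rintro _ ⟨I, hI, rfl⟩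
    exact Submodule.fg_span (Set.toFinite _)
  · rintro _ ⟨I, hI, rfl⟩
    exact salient_hull (hli' I hI)
  · rintro _ ⟨I, hI, rfl⟩ τ hτ
    obtain ⟨J, hJ, rfl⟩ := eq_hull_of_isFaceOf hτ
    exact ⟨J, hT.down I hI J hJ, rfl⟩
  · rintro _ ⟨I, hI, rfl⟩ _ ⟨J, hJ, rfl⟩
    have := hx.inf_eq hT hli hI hJ
    simp only [coneOf] at this
    rw [this]
    exact isFaceOf_hull (hli' I hI) Finset.inter_subset_left

theorem isAdmissible (hT : IsThinComplex D)
    (hli : ∀ I ∈ D, I.card = d → LinearIndepOn ℝ (gen h) (I : Set (Idx d m)))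
    (hx : IsStrictVertexSystem D h b x) : IsAdmissible D h := by
  classical
  have hli' : ∀ I ∈ D, LinearIndepOn ℝ (gen h) (I : Set (Idx d m)) := fun I hI => by
    obtain ⟨J, hJ, hJc, hIJ⟩ := hT.pure I hI
    exact (hli J hJ hJc).mono (by exact_mod_cast hIJ)
  have hsing : ∀ I ∈ D, ∀ i ∈ I, i ∈ rayIdx D := fun I hI i hi =>
    hT.down I hI {i} (Finset.singleton_subset_iff.2 hi)
  refine ⟨⟨hx.isFan hT hli, ?_, ?_⟩, ?_⟩
  · obtain ⟨I, hI, hc, -⟩ := hT.pure ∅ hT.empty_mem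
    obtain ⟨u, h1, -⟩ := exists_dual (hli I hI hc) hc
    rw [eq_top_iff]
    intro v _
    rw [← h1 v]
    exact Submodule.sum_mem _ fun i hi => Submodule.smul_mem _ _
      (Submodule.subset_span ⟨i, hsing I hI i hi, rfl⟩)
  · intro ρ
    constructor
    · rintro ⟨⟨I, hI, rfl⟩, hr⟩
      rw [finrank_span_hull (hli' I hI), Finset.card_eq_one] at hr
      obtain ⟨i, rfl⟩ := hr
      exact ⟨i, hI, coneOf_singleton i⟩
    · rintro ⟨i, hi, rfl⟩
      have hi' : ({i} : Finset (Idx d m)) ∈ D := hi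
      rw [← coneOf_singleton]
      exact ⟨coneOf_mem_fanOf hi', by rw [finrank_span_hull (hli' _ hi'), Finset.card_singleton]⟩
  · have hfull : ∀ I ∈ D, ∀ i, i ∈ I ↔ i ∈ rayIdx D ∧ gen h i ∈ coneOf h I := by
      refine fun I hI i => ⟨fun hi => ⟨hsing I hI i hi, gen_mem_hull hi⟩, fun ⟨hi, hg⟩ => ?_⟩
      have hi' : ({i} : Finset (Idx d m)) ∈ D := hi
      have h1 : gen h i ∈ coneOf h ({i} ∩ I) := by
        rw [← hx.inf_eq hT hli hi' hI]
        exact ⟨gen_mem_hull (Finset.mem_singleton_self i), hg⟩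
      have h2 := mem_of_gen_mem_hull (hli' _ hi') Finset.inter_subset_left
        (Finset.mem_singleton_self i) h1
      exact (Finset.mem_inter.1 h2).2
    ext I
    constructor
    · rintro ⟨_, ⟨J, hJ, rfl⟩, hIJ⟩
      have : I = J := by
        ext i
        rw [hIJ i, hfull J hJ i]
      rwa [this]
    · intro hI
      exact ⟨_, coneOf_mem_fanOf hI, hfull I hI⟩

theorem isPolytopal (hT : IsThinComplex D)
    (hli : ∀ I ∈ D, I.card = d → LinearIndepOn ℝ (gen h) (I : Set (Idx d m)))
    (hx : IsStrictVertexSystem D h b x) : IsPolytopal (fanOf D h) := by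
  have hcov := hx.exists_full_cone hT hli
  obtain ⟨φ, hφ, h1, h2⟩ := hx.exists_supportFunction hT hcov
  refine ⟨fun v => ?_, φ, hφ, fun v w hvw => ?_⟩
  · obtain ⟨I, hI, -, hv⟩ := hcov v
    exact ⟨_, coneOf_mem_fanOf hI, hv⟩
  · obtain ⟨I, hI, hc, hI'⟩ := hcov (v + w)
    rw [h1 I hI hc _ hI', inner_add_right]
    -- If superadditivity is not strict, the form `x I`, minimal at `v + w`, is minimal at `v` and
    -- at `w` as well, so both lie in the cone of `I`.
    by_contra! hle
    have hv := h2 I hI hc v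
    have hw := h2 I hI hc w
    have key : ∀ z, (φ z : ℝ) = inner ℝ (x I) z → z ∈ coneOf h I := by
      intro z hz
      obtain ⟨J, hJ, hJc, hzJ⟩ := hcov z
      exact hx.mem_of_inner_eq hI hc hJ hJc hzJ (by rw [← hz, h1 J hJ hJc z hzJ])
    exact hvw ⟨_, coneOf_mem_fanOf hI, key v (by linarith), key w (by linarith)⟩

end IsStrictVertexSystem

end VertexSystem


/-! ### Vertices and slacks as functions of `h` and `b`. -/

section Vertices

variable {d m : ℕ}

/-- The matrix with rows `h(e_i)`, `i ∈ I`. -/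
noncomputable def facetMatrix (h : Calibration d m) (I : Finset (Idx d m)) (hI : I.card = d) :
    Matrix (Fin d) (Fin d) ℝ :=
  Matrix.of fun r s => gen h ((I.equivFinOfCardEq hI).symm r) s

/-- The point `x` with `⟪x, h(e_i)⟫ = -b_i` for `i ∈ I`, as a linear function of `b`. -/
noncomputable def vertex (h : Calibration d m) (I : Finset (Idx d m)) :
    (Idx d m → ℝ) →ₗ[ℝ] Vec d :=
  if hI : I.card = d then
    (WithLp.linearEquiv 2 ℝ (Fin d → ℝ)).symm.toLinearMap ∘ₗ
      (facetMatrix h I hI)⁻¹.mulVecLin ∘ₗ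
      (-LinearMap.funLeft ℝ ℝ fun r => ((I.equivFinOfCardEq hI).symm r : Idx d m))
  else 0

/-- The amount by which the inequality with index `i` holds at the vertex attached to `I`. -/
noncomputable def slack (h : Calibration d m) (I : Finset (Idx d m)) (i : Idx d m) :
    (Idx d m → ℝ) →ₗ[ℝ] ℝ :=
  innerₛₗ ℝ (gen h i) ∘ₗ vertex h I + LinearMap.proj i

theorem slack_apply (h : Calibration d m) (I : Finset (Idx d m)) (i : Idx d m)
    (b : Idx d m → ℝ) : slack h I i b = inner ℝ (vertex h I b) (gen h i) + b i := by
  simp [slack, real_inner_comm]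

theorem isUnit_det_facetMatrix_iff {h : Calibration d m} {I : Finset (Idx d m)} (hI : I.card = d) :
    IsUnit (facetMatrix h I hI).det ↔ LinearIndepOn ℝ (gen h) (I : Set (Idx d m)) := by
  rw [← Matrix.isUnit_iff_isUnit_det, ← Matrix.linearIndependent_rows_iff_isUnit]
  have h1 : (facetMatrix h I hI).row = (WithLp.linearEquiv 2 ℝ (Fin d → ℝ)).toLinearMap ∘
      (fun i : I => gen h i) ∘ (I.equivFinOfCardEq hI).symm := rfl
  rw [h1, LinearMap.linearIndependent_iff _ (LinearEquiv.ker _), linearIndependent_equiv]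
  rfl

open scoped Matrix in
theorem inner_vertex {h : Calibration d m} {I : Finset (Idx d m)} (hI : I.card = d)
    (hli : LinearIndepOn ℝ (gen h) (I : Set (Idx d m))) (b : Idx d m → ℝ) {i : Idx d m}
    (hi : i ∈ I) : (inner ℝ (vertex h I b) (gen h i) : ℝ) = -b i := by
  have hu := (isUnit_det_facetMatrix_iff hI).2 hli
  have h1 : facetMatrix h I hI *ᵥ (WithLp.ofLp (vertex h I b)) =
      fun r => -b ((I.equivFinOfCardEq hI).symm r) := by
    simp only [vertex, hI, dite_true]
    change facetMatrix h I hI *ᵥ ((facetMatrix h I hI)⁻¹ *ᵥ _) = _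
    rw [Matrix.mulVec_mulVec, Matrix.mul_nonsing_inv _ hu, Matrix.one_mulVec]
    rfl
  have h2 := congrFun h1 (I.equivFinOfCardEq hI ⟨i, hi⟩)
  simp only [Equiv.symm_apply_apply] at h2
  rw [← h2, Matrix.mulVec, EuclideanSpace.inner_eq_star_dotProduct]
  simp [facetMatrix]

theorem eq_of_inner_eq {ι : Type*} {g : ι → Vec d} {I : Finset ι} (hI : I.card = d)
    (hli : LinearIndepOn ℝ g (I : Set ι)) {x y : Vec d}
    (h : ∀ i ∈ I, (inner ℝ x (g i) : ℝ) = inner ℝ y (g i)) : x = y := by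
  obtain ⟨u, h1, -⟩ := exists_dual hli hI
  refine ext_inner_right ℝ fun v => ?_
  rw [← h1 v]
  simp only [inner_sum, inner_smul_right]
  exact Finset.sum_congr rfl fun i hi => by rw [h i hi]

/-- A lift of the class `[b]`. -/
def liftClass (d m : ℕ) : (Fin m → ℝ) →ₗ[ℝ] (Idx d m → ℝ) where
  toFun χ := Sum.elim 0 χ
  map_add' χ ψ := by funext i; rcases i with i | i <;> simp
  map_smul' c χ := by funext i; rcases i with i | i <;> simp

theorem galeT_liftClass (h : Calibration d m) (χ : Fin m → ℝ) :
    galeT h (liftClass d m χ) = χ := by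
  funext j
  simp [galeT, liftClass]

/-- The kernel of `k^⊤` consists of the vectors `(⟪u, h(e_i)⟫)_i`, so changing the representative of
`[b]` translates `P_b`. Since `h(e_i) = e_i` for `i ≤ d`, `u` is read off the first `d` coordinates.
-/
theorem exists_translation {h : Calibration d m} {b c : Idx d m → ℝ} (hbc : galeT h b = galeT h c) :
    ∃ u : Vec d, ∀ i, b i = c i - inner ℝ u (gen h i) := by
  refine ⟨WithLp.toLp 2 fun i => c (Sum.inl i) - b (Sum.inl i), fun i => ?_⟩
  rcases i with i | j
  · simp [gen, EuclideanSpace.inner_single_right]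
  · have := congrFun hbc j
    simp only [galeT, LinearMap.coe_mk, AddHom.coe_mk] at this
    simp only [gen, Sum.elim_inr, PiLp.inner_apply, RCLike.inner_apply, conj_trivial, mul_sub,
      Finset.sum_sub_distrib]
    linarith

theorem slack_congr {h : Calibration d m} {I : Finset (Idx d m)} (hI : I.card = d)
    (hli : LinearIndepOn ℝ (gen h) (I : Set (Idx d m))) {b c : Idx d m → ℝ}
    (hbc : galeT h b = galeT h c) (i : Idx d m) : slack h I i b = slack h I i c := by
  obtain ⟨u, hu⟩ := exists_translation hbc
  have : vertex h I b = vertex h I c + u := by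
    refine eq_of_inner_eq hI hli fun i hi => ?_
    rw [inner_add_left, inner_vertex hI hli _ hi, inner_vertex hI hli _ hi, hu i]; ring
  rw [slack_apply, slack_apply, this, inner_add_left, hu i]; ring

theorem slack_galeT {h : Calibration d m} {I : Finset (Idx d m)} (hI : I.card = d)
    (hli : LinearIndepOn ℝ (gen h) (I : Set (Idx d m))) (b : Idx d m → ℝ) (i : Idx d m) :
    slack h I i (liftClass d m (galeT h b)) = slack h I i b :=
  slack_congr hI hli (galeT_liftClass h _) i

end Vertices

/-! ### The chamber of the secondary fan and the description of `Ω̂(D)`. -/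

section Chamber

variable {d m : ℕ} {D : Set (Finset (Idx d m))} {h : Calibration d m} {b : Idx d m → ℝ}

/-- The calibrations for which the vectors `h(e_i)`, `i ∈ I`, are a basis for all maximal
`I ∈ D`. -/
def nondegenerate (D : Set (Finset (Idx d m))) : Set (Calibration d m) :=
  {h | ∀ I ∈ D, I.card = d → LinearIndepOn ℝ (gen h) (I : Set (Idx d m))}

/-- The open polyhedral cone of all `[b]` for which all slacks are positive. -/
def chamber (D : Set (Finset (Idx d m))) (h : Calibration d m) : Set (Fin m → ℝ) :=
  {χ | ∀ I ∈ D, I.card = d → ∀ i ∉ I, 0 < slack h I i (liftClass d m χ)}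

theorem isVertexSystem_vertex (hli : h ∈ nondegenerate D)
    (hb : ∀ I ∈ D, I.card = d → ∀ i ∉ I, 0 ≤ slack h I i b) :
    IsVertexSystem D h b fun I => vertex h I b := by
  refine ⟨fun I hI hc i hi => inner_vertex hc (hli I hI hc) b hi, fun I hI hc i => ?_⟩
  by_cases hi : i ∈ I
  · exact (inner_vertex hc (hli I hI hc) b hi).ge
  · have := hb I hI hc i hi
    rw [slack_apply] at this
    linarith

theorem isStrictVertexSystem_vertex (hli : h ∈ nondegenerate D)
    (hb : ∀ I ∈ D, I.card = d → ∀ i ∉ I, 0 < slack h I i b) :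
    IsStrictVertexSystem D h b fun I => vertex h I b where
  toIsVertexSystem := isVertexSystem_vertex hli fun I hI hc i hi => (hb I hI hc i hi).le
  lt I hI hc i hi := by
    have := hb I hI hc i hi
    rw [slack_apply] at this
    linarith

theorem galeT_mem_chamber_iff (hli : h ∈ nondegenerate D) :
    galeT h b ∈ chamber D h ↔ ∀ I ∈ D, I.card = d → ∀ i ∉ I, 0 < slack h I i b := by
  refine forall₄_congr fun I hI hc i => ?_
  rw [slack_galeT hc (hli I hI hc)]

section Support

variable {φ : Vec d → ℝ}

theorem IsSupportFunction.map_smul (hφ : IsSupportFunction (fanOf D h) φ)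
    (hcomp : IsComplete (fanOf D h)) {c : ℝ} (hc : 0 ≤ c) (v : Vec d) : φ (c • v) = c * φ v := by
  obtain ⟨σ, hσ, hv⟩ := hcomp v
  obtain ⟨l, hl⟩ := hφ σ hσ
  rw [hl v hv, hl _ (PointedCone.smul_mem _ hc hv), _root_.map_smul, smul_eq_mul]

theorem IsConvexSupportFunction.add_le (hφ : IsConvexSupportFunction (fanOf D h) φ)
    (hcomp : IsComplete (fanOf D h)) (v w : Vec d) : φ v + φ w ≤ φ (v + w) := by
  have := hφ.2.2 (Set.mem_univ ((2 : ℝ) • v)) (Set.mem_univ ((2 : ℝ) • w))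
    (show (0 : ℝ) ≤ 1 / 2 by norm_num) (show (0 : ℝ) ≤ 1 / 2 by norm_num) (by norm_num)
  rw [hφ.1.map_smul hcomp zero_le_two, hφ.1.map_smul hcomp zero_le_two, smul_smul, smul_smul] at this
  norm_num at this
  linarith

variable {I : Finset (Idx d m)} {x : Vec d}

theorem IsSupportFunction.eq_inner (hφ : IsSupportFunction (fanOf D h) φ) (hI : I ∈ D)
    (hx : ∀ i ∈ I, (inner ℝ x (gen h i) : ℝ) = φ (gen h i)) {v : Vec d} (hv : v ∈ coneOf h I) :
    φ v = inner ℝ x v := by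
  obtain ⟨l, hl⟩ := hφ _ (coneOf_mem_fanOf hI)
  rw [hl v hv]
  obtain ⟨c, -, -, rfl⟩ := mem_hull_image.1 hv
  simp only [map_sum, _root_.map_smul, inner_sum, inner_smul_right, smul_eq_mul]
  refine Finset.sum_congr rfl fun i hi => ?_
  rw [hx i hi, hl _ (gen_mem_hull hi)]

/-- Adding a large multiple of `∑ i ∈ I, h(e_i)` moves `v` into the cone of `I`, where `φ` is
linear; superadditivity does the rest. -/
theorem IsConvexSupportFunction.le_inner (hφ : IsConvexSupportFunction (fanOf D h) φ)
    (hcomp : IsComplete (fanOf D h)) (hI : I ∈ D) (hc : I.card = d)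
    (hli : LinearIndepOn ℝ (gen h) (I : Set (Idx d m)))
    (hx : ∀ i ∈ I, (inner ℝ x (gen h i) : ℝ) = φ (gen h i)) (v : Vec d) :
    φ v ≤ inner ℝ x v := by
  obtain ⟨N, hN, hmem⟩ := exists_smul_add_mem_hull hli hc v
  have h1 := hφ.add_le hcomp (N • ∑ i ∈ I, gen h i) v
  rw [hφ.1.eq_inner hI hx hmem, hφ.1.eq_inner hI hx (PointedCone.smul_mem _ hN.le
    (Submodule.sum_mem _ fun i hi => gen_mem_hull hi)), inner_add_right] at h1
  linarith

/-- The same argument is strict unless `v` shares a cone with an interior point of the cone of `I`.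
Such a cone comes from some `K ⊇ I`, and purity bounds its size, so it is the cone of `I` itself. -/
theorem IsStrictlyConvexSupportFunction.lt_inner
    (hφ : IsStrictlyConvexSupportFunction (fanOf D h) φ) (hD : IsAdmissible D h)
    (hT : IsThinComplex D) (hI : I ∈ D) (hc : I.card = d)
    (hli : LinearIndepOn ℝ (gen h) (I : Set (Idx d m)))
    (hx : ∀ i ∈ I, (inner ℝ x (gen h i) : ℝ) = φ (gen h i)) {v : Vec d} (hv : v ∉ coneOf h I) :
    φ v < inner ℝ x v := by
  obtain ⟨N, hN, hmem⟩ := exists_smul_add_mem_hull hli hc v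
  have h1 := hφ.2 (N • ∑ i ∈ I, gen h i) v ?_
  · rw [hφ.1.1.eq_inner hI hx hmem, hφ.1.1.eq_inner hI hx (PointedCone.smul_mem _ hN.le
      (Submodule.sum_mem _ fun i hi => gen_mem_hull hi)), inner_add_right] at h1
    linarith
  · rintro ⟨_, ⟨K, hK, rfl⟩, hw, hvK⟩
    have hw' : ∑ i ∈ I, gen h i ∈ coneOf h K := by
      have := PointedCone.smul_mem (coneOf h K) (inv_nonneg.2 hN.le) hw
      rwa [smul_smul, inv_mul_cancel₀ hN.ne', one_smul] at this
    have hIK := hD.subset_of_sum_mem hK hI hli hw'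
    obtain ⟨K', -, hK'c, hKK'⟩ := hT.pure K hK
    have : I = K' := Finset.eq_of_subset_of_card_le (hIK.trans hKK') (by rw [hc, hK'c])
    exact hv (hull_mono (this ▸ hKK') hvK)

end Support

/-- Inequalities for the cones of the secondary fan. -/
theorem gkzCone_eq (hT : IsThinComplex D) (hD : IsAdmissible D h) (hli : h ∈ nondegenerate D)
    (hcomp : IsComplete (fanOf D h)) (hcov : ∀ v, ∃ I ∈ D, I.card = d ∧ v ∈ coneOf h I) :
    gkzCone D h =
      {χ | ∀ I ∈ D, I.card = d → ∀ i ∉ I, 0 ≤ slack h I i (liftClass d m χ)} := by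
  ext χ
  constructor
  · rintro ⟨b, ⟨φ, hφ, h1, h2⟩, rfl⟩ I hI hc i hi
    rw [slack_galeT hc (hli I hI hc), slack_apply]
    have h3 := hφ.le_inner hcomp hI hc (hli I hI hc) (x := vertex h I b) (fun j hj => by
      rw [inner_vertex hc (hli I hI hc) b hj, h1 j (hD.mem_rayIdx hI hj)]) (gen h i)
    have h4 : -b i ≤ φ (gen h i) := by
      by_cases hr : i ∈ rayIdx D
      · exact (h1 i hr).ge
      · exact h2 i hr
    linarith
  · intro hχ
    have hx := isVertexSystem_vertex hli hχ
    obtain ⟨φ, hφ, h1, -⟩ := hx.exists_supportFunction hT hcov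
    refine ⟨liftClass d m χ, ⟨φ, hφ, fun j hj => ?_, fun i _ => ?_⟩, galeT_liftClass h χ⟩
    · obtain ⟨I, hI, hc, hjI⟩ := hT.pure {j} hj
      have hjI' := hjI (Finset.mem_singleton_self j)
      rw [h1 I hI hc _ (gen_mem_hull hjI'), hx.eq I hI hc j hjI']
    · obtain ⟨I, hI, hc, hv⟩ := hcov (gen h i)
      rw [h1 I hI hc _ hv]
      exact hx.le I hI hc i

theorem isOpen_chamber : IsOpen (chamber D h) := by
  have : chamber D h = ⋂ I ∈ {I | I ∈ D ∧ I.card = d}, ⋂ i ∈ {i | i ∉ I},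
      {χ | 0 < slack h I i (liftClass d m χ)} := by
    ext χ
    simp [chamber]
  rw [this]
  refine (Set.toFinite _).isOpen_biInter fun I _ => (Set.toFinite _).isOpen_biInter fun i _ => ?_
  exact isOpen_lt continuous_const
    (LinearMap.continuous_of_finiteDimensional (slack h I i ∘ₗ liftClass d m))

theorem smul_mem_chamber {c : ℝ} (hc : 0 < c) {χ : Fin m → ℝ} (hχ : χ ∈ chamber D h) :
    c • χ ∈ chamber D h := fun I hI hIc i hi => by
  rw [_root_.map_smul, _root_.map_smul]
  exact mul_pos hc (hχ I hI hIc i hi)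

theorem convex_chamber : Convex ℝ (chamber D h) := by
  refine convex_iff_forall_pos.2 fun x hx y hy a b ha hb _ I hI hc i hi => ?_
  rw [map_add, map_add]
  exact add_pos (smul_mem_chamber ha hx I hI hc i hi) (smul_mem_chamber hb hy I hI hc i hi)

theorem slack_single (I : Finset (Idx d m)) (hli : LinearIndepOn ℝ (gen h) (I : Set (Idx d m)))
    (hc : I.card = d) {i : Idx d m} (hi : i ∉ I) : slack h I i (Pi.single i 1) = 1 := by
  have : vertex h I (Pi.single i 1) = 0 := by
    refine eq_of_inner_eq hc hli fun j hj => ?_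
    rw [inner_vertex hc hli _ hj, inner_zero_left,
      Pi.single_eq_of_ne (by rintro rfl; exact hi hj), neg_zero]
  rw [slack_apply, this, inner_zero_left, Pi.single_eq_same, zero_add]

/-- Each slack is a nonzero form: by `slack_single`, moving by `-ε k^⊤ e_i` lowers the slack at `(I,
i)` by exactly `ε`. It is therefore positive at interior points. -/
theorem interior_gkzCone (hT : IsThinComplex D) (hD : IsAdmissible D h) (hli : h ∈ nondegenerate D)
    (hcomp : IsComplete (fanOf D h)) (hcov : ∀ v, ∃ I ∈ D, I.card = d ∧ v ∈ coneOf h I) :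
    interior (gkzCone D h) = chamber D h := by
  rw [gkzCone_eq hT hD hli hcomp hcov]
  refine subset_antisymm ?_ (interior_maximal (fun χ hχ I hI hc i hi => (hχ I hI hc i hi).le)
    isOpen_chamber)
  intro χ hχ I hI hc i hi
  set S := {χ | ∀ I ∈ D, I.card = d → ∀ i ∉ I, 0 ≤ slack h I i (liftClass d m χ)} with hS
  have hcont : Filter.Tendsto (fun ε : ℝ => χ - ε • galeT h (Pi.single i 1)) (nhds 0) (nhds χ) := by
    have : Continuous fun ε : ℝ => χ - ε • galeT h (Pi.single i 1) := by fun_prop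
    simpa using this.tendsto 0
  have hev := (hcont.eventually (mem_interior_iff_mem_nhds.1 hχ)).filter_mono
    (nhdsWithin_le_nhds (s := Set.Ioi 0))
  obtain ⟨ε, hε, hpos⟩ := (hev.and self_mem_nhdsWithin).exists
  have h1 := hε I hI hc i hi
  rw [map_sub, map_smul, map_sub, map_smul, slack_galeT hc (hli I hI hc),
    slack_single I (hli I hI hc) hc hi, smul_eq_mul, mul_one] at h1
  have : (0 : ℝ) < ε := hpos
  linarith

theorem chamber_nonempty (hT : IsThinComplex D) (hD : IsAdmissible D h) (hli : h ∈ nondegenerate D)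
    (hpoly : IsPolytopal (fanOf D h)) : (chamber D h).Nonempty := by
  classical
  obtain ⟨hcomp, φ, hφ⟩ := hpoly
  -- The added `1` is for the virtual generators, which may lie in the cone of `I`, where strict
  -- convexity of `φ` gives no strict inequality.
  refine ⟨galeT h fun i => -φ (gen h i) + if i ∈ rayIdx D then 0 else 1, ?_⟩
  rw [galeT_mem_chamber_iff hli]
  intro I hI hc i hi
  set b : Idx d m → ℝ := fun i => -φ (gen h i) + if i ∈ rayIdx D then 0 else 1 with hb
  have hx : ∀ j ∈ I, (inner ℝ (vertex h I b) (gen h j) : ℝ) = φ (gen h j) := fun j hj => by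
    rw [inner_vertex hc (hli I hI hc) b hj]
    simp [hb, hD.mem_rayIdx hI hj]
  rw [slack_apply]
  by_cases hr : i ∈ rayIdx D
  · have := hφ.lt_inner hD hT hI hc (hli I hI hc) hx
      (v := gen h i) fun hg => hi (hD.mem_of_gen_mem hI hr hg)
    simp only [hb, hr, if_true]
    linarith
  · have := hφ.1.le_inner hcomp hI hc (hli I hI hc) hx (gen h i)
    simp only [hb, hr, if_false]
    linarith

/-- The faces of `P_b` for `[b]` in the chamber. -/
theorem exists_mem_face (hT : IsThinComplex D) (hli : h ∈ nondegenerate D)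
    {x : Finset (Idx d m) → Vec d} (hx : IsStrictVertexSystem D h b x) {J : Finset (Idx d m)}
    (hJ : J ∈ D) :
    ∃ y : Vec d, ∀ i, (i ∈ J → (inner ℝ y (gen h i) : ℝ) = -b i) ∧
      (i ∉ J → -b i < (inner ℝ y (gen h i) : ℝ)) := by
  classical
  obtain ⟨I, hI, hc, hJI⟩ := hT.pure J hJ
  obtain ⟨u, -, h2⟩ := exists_dual (hli I hI hc) hc
  -- Moving from `x I` along `z` keeps the equalities indexed by `J` and releases those in `I \ J`;
  -- small steps keep the inequalities outside `I` strict.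
  set z : Vec d := ∑ i ∈ I \ J, u i with hz
  have hz1 : ∀ i ∈ I, (inner ℝ z (gen h i) : ℝ) = if i ∈ J then 0 else 1 := by
    intro i hi
    have hu : ∀ k ∈ I, (inner ℝ (u k) (gen h i) : ℝ) = if k = i then 1 else 0 := by
      intro k hk
      have := h2 (fun j => if j = i then 1 else 0) k hk
      simpa [ite_smul, Finset.sum_ite_eq', hi] using this
    rw [hz, sum_inner, Finset.sum_congr rfl fun k hk => hu k (Finset.mem_sdiff.1 hk).1]
    simp [hi]
  have hev : ∀ᶠ ε in nhdsWithin (0 : ℝ) (Set.Ioi 0), ∀ i : Idx d m, i ∉ I →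
      -b i < (inner ℝ (x I + ε • z) (gen h i) : ℝ) := by
    rw [Filter.eventually_all]
    intro i
    by_cases hi : i ∈ I
    · simp [hi]
    · have hcont : Continuous fun ε : ℝ => (inner ℝ (x I + ε • z) (gen h i) : ℝ) := by fun_prop
      have h3 := (hcont.tendsto 0).eventually (lt_mem_nhds (a := -b i)
        (by simpa using hx.lt I hI hc i hi))
      exact (h3.filter_mono nhdsWithin_le_nhds).mono fun ε hε _ => hε
  obtain ⟨ε, hε, hpos⟩ := (hev.and self_mem_nhdsWithin).exists
  have hpos' : (0 : ℝ) < ε := hpos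
  refine ⟨x I + ε • z, fun i => ⟨fun hi => ?_, fun hi => ?_⟩⟩
  · rw [inner_add_left, inner_smul_left, hz1 i (hJI hi), hx.eq I hI hc i (hJI hi)]
    simp [hi]
  · by_cases hiI : i ∈ I
    · rw [inner_add_left, inner_smul_left, hz1 i hiI, hx.eq I hI hc i hiI]
      simpa [hi] using hpos'
    · exact hε i hiI

theorem mem_chamber_iff_faceType_eq (hT : IsThinComplex D) (hli : h ∈ nondegenerate D) :
    galeT h b ∈ chamber D h ↔ faceType h b = D := by
  rw [galeT_mem_chamber_iff hli]
  constructor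
  · intro hb
    have hx := isStrictVertexSystem_vertex hli hb
    ext J
    constructor
    · rintro ⟨y, hy, hJ⟩
      -- The form `∑ j ∈ J, h(e_j)` is minimal on `P_b` at the vertex of this `I`. At `y` each of
      -- its summands attains its lower bound `-b_j`, so the vertex attains all of them too, and
      -- strictness forces `J ⊆ I`.
      obtain ⟨I, hI, hc, hv⟩ := hx.exists_full_cone hT hli (∑ j ∈ J, gen h j)
      refine hT.down I hI J fun j hj => ?_
      obtain ⟨c, hc0, -, hcv⟩ := mem_hull_image.1 hv
      have hy1 : ∀ i, -b i ≤ (inner ℝ y (gen h i) : ℝ) := fun i => hy i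
      have h1 : (inner ℝ (vertex h I b) (∑ j ∈ J, gen h j) : ℝ) ≤ inner ℝ y (∑ j ∈ J, gen h j) := by
        rw [← hcv, inner_sum, inner_sum]
        refine Finset.sum_le_sum fun i hi => ?_
        rw [inner_smul_right, inner_smul_right, hx.eq I hI hc i hi]
        exact mul_le_mul_of_nonneg_left (hy1 i) (hc0 i)
      rw [inner_sum, inner_sum] at h1
      have h2 : ∀ j ∈ J, (inner ℝ y (gen h j) : ℝ) ≤ inner ℝ (vertex h I b) (gen h j) :=
        fun j hj => by rw [(hJ j).1 hj]; exact hx.le I hI hc j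
      have h3 := (Finset.sum_eq_sum_iff_of_le h2).1 (le_antisymm (Finset.sum_le_sum h2) h1) j hj
      by_contra hjI
      have := hx.lt I hI hc j hjI
      rw [← h3, (hJ j).1 hj] at this
      exact lt_irrefl _ this
    · intro hJ
      obtain ⟨y, hy⟩ := exists_mem_face hT hli hx hJ
      refine ⟨y, fun i => ?_, fun i => ⟨(hy i).1, fun heq => ?_⟩⟩
      · by_cases hi : i ∈ J
        · exact ((hy i).1 hi).ge
        · exact ((hy i).2 hi).le
      · by_contra hi
        exact ((hy i).2 hi).ne heq.symm
  -- A point whose equalities are exactly those of the facet `I` must be the vertex of `I`, so the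
  -- remaining slacks there are nonzero.
  · intro hf I hI hc i hi
    have hI' := hI
    rw [← hf] at hI'
    obtain ⟨y, hy, hyI⟩ := hI'
    have : y = vertex h I b := eq_of_inner_eq hc (hli I hI hc) fun j hj => by
      rw [(hyI j).1 hj, inner_vertex hc (hli I hI hc) b hj]
    rw [slack_apply, ← this]
    have h1 : -b i ≤ (inner ℝ y (gen h i) : ℝ) := hy i
    have h2 : (inner ℝ y (gen h i) : ℝ) ≠ -b i := fun h => hi ((hyI i).2 h)
    have := lt_of_le_of_ne h1 h2.symm
    linarith

variable {H : Set (Calibration d m)}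

theorem nondegenerate_of_mem_omega (hT : IsThinComplex D) (hh : h ∈ omega H D) :
    h ∈ nondegenerate D :=
  fun _ hI _ => hh.1.2.linearIndepOn hT.down hI

theorem interior_gkzCone_of_mem_omega (hT : IsThinComplex D) (hh : h ∈ omega H D) :
    interior (gkzCone D h) = chamber D h := by
  have hli := nondegenerate_of_mem_omega hT hh
  exact interior_gkzCone hT hh.1.2 hli hh.2.1
    (exists_full_cone hh.2.1 fun I hI => hh.1.2.linearIndepOn hT.down hI)

/-- A point `(h, [b])` of `Ω̂(D)` is given by finitely many strict inequalities. -/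
theorem mem_omegaHat_iff (hT : IsThinComplex D) {χ : Fin m → ℝ} :
    (h, χ) ∈ omegaHat H D ↔ h ∈ H ∧ h ∈ nondegenerate D ∧ χ ∈ chamber D h := by
  constructor
  · rintro ⟨-, hh, hχ⟩
    exact ⟨hh.1.1, nondegenerate_of_mem_omega hT hh, by
      rwa [← interior_gkzCone_of_mem_omega hT hh]⟩
  · rintro ⟨hH, hli, hχ⟩
    have hx := isStrictVertexSystem_vertex hli hχ
    have hh : h ∈ omega H D := ⟨⟨hH, hx.isAdmissible hT hli⟩, hx.isPolytopal hT hli⟩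
    refine ⟨⟨hH, liftClass d m χ, galeT_liftClass h χ, ?_⟩, hh, by
      rwa [interior_gkzCone_of_mem_omega hT hh]⟩
    -- The face with index set `∅` supplies a point where all inequalities are strict, so `P_b`
    -- contains a nonempty open set.
    obtain ⟨y, hy⟩ := exists_mem_face hT hli hx hT.empty_mem
    let U : Set (Vec d) := ⋂ i, {y | -(liftClass d m χ) i < (inner ℝ y (gen h i) : ℝ)}
    have hU : IsOpen U := isOpen_iInter_of_finite fun i =>
      isOpen_lt continuous_const (by fun_prop)
    have hyU : y ∈ U := Set.mem_iInter.2 fun i => (hy i).2 (Finset.notMem_empty i)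
    rw [eq_top_iff, ← hU.affineSpan_eq_top ⟨y, hyU⟩]
    exact affineSpan_mono ℝ fun z hz i => (Set.mem_iInter.1 hz i).le

theorem mem_omegaHat_iff_of_mem_omega (hT : IsThinComplex D) (hh : h ∈ omega H D)
    {χ : Fin m → ℝ} : (h, χ) ∈ omegaHat H D ↔ χ ∈ chamber D h := by
  rw [mem_omegaHat_iff hT]
  exact ⟨fun h1 => h1.2.2, fun h1 => ⟨hh.1.1, nondegenerate_of_mem_omega hT hh, h1⟩⟩

end Chamber


/-! ### Trivializing families of open polyhedral cones. -/

section Fibration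

variable {X Z : Type} {m : ℕ}

section Homeomorph

variable [TopologicalSpace X] [TopologicalSpace Z]

theorem isRealFibration_of_homeomorph {p : Z → X} (e : Z ≃ₜ X × (Fin m → ℝ))
    (he : ∀ z, (e z).1 = p z) : IsRealFibration m p := fun x =>
  ⟨{ toOpenPartialHomeomorph := e.toOpenPartialHomeomorph
     baseSet := Set.univ
     open_baseSet := isOpen_univ
     source_eq := by simp
     target_eq := by simp
     proj_toFun := fun z _ => he z }, Set.mem_univ x⟩

theorem isHomotopyEquivalence_of_homeomorph {p : Z → X} (e : Z ≃ₜ X × (Fin m → ℝ))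
    (he : ∀ z, (e z).1 = p z) : IsHomotopyEquivalence p := by
  have hp : Continuous p := by
    have : p = fun z => (e z).1 := funext fun z => (he z).symm
    rw [this]; fun_prop
  let s : C(X, Z) := ⟨fun x => e.symm (x, 0), by fun_prop⟩
  -- Scaling the fiber coordinate by `t ∈ [0, 1]` joins the zero section composed with `p` to the
  -- identity.
  refine ⟨⟨⟨p, hp⟩, s, ⟨⟨⟨fun q => e.symm (p q.2, (q.1 : ℝ) • (e q.2).2), ?_⟩, ?_, ?_⟩⟩, ?_⟩, rfl⟩
  · exact e.symm.continuous.comp (by fun_prop)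
  · intro z; simp [s]
  · intro z
    simp only [Set.Icc.coe_one, one_smul, ContinuousMap.id_apply]
    rw [← he z, Prod.mk.eta, e.symm_apply_apply]
  · have : (⟨p, hp⟩ : C(Z, X)).comp s = ContinuousMap.id X := by
      ext x
      simp [s, ← he]
    rw [this]

end Homeomorph

variable {κ : Type} [Fintype κ] (L : κ → X → (Fin m → ℝ) →ₗ[ℝ] ℝ) (s : X → Fin m → ℝ)

/-- The Minkowski functional of the translated polyhedral cone
`{v | ∀ k, 0 < L k x (s x + v)}`. -/
noncomputable def coneGauge (x : X) (v : Fin m → ℝ) : NNReal :=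
  -- Truncation by `Real.toNNReal` gives gauge `0` to the directions along which no `L k x`
  -- decreases.
  Finset.univ.sup fun k => Real.toNNReal (-(L k x v) / L k x (s x))

variable {L s}

theorem coneGauge_smul (x : X) (t : NNReal) (v : Fin m → ℝ) :
    coneGauge L s x ((t : ℝ) • v) = t * coneGauge L s x v := by
  rw [coneGauge, coneGauge, NNReal.mul_finset_sup]
  refine Finset.sup_congr rfl fun k _ => ?_
  rw [map_smul, smul_eq_mul, ← mul_neg, mul_div_assoc, Real.toNNReal_mul t.coe_nonneg, Real.toNNReal_coe]

theorem coneGauge_lt_one_iff {x : X} (hs : ∀ k, 0 < L k x (s x)) (v : Fin m → ℝ) :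
    coneGauge L s x v < 1 ↔ ∀ k, 0 < L k x (s x + v) := by
  rw [coneGauge, Finset.sup_lt_iff (by simp)]
  simp only [Finset.mem_univ, true_imp_iff, Real.toNNReal_lt_one]
  refine forall_congr' fun k => ?_
  rw [div_lt_one (hs k), map_add]
  constructor <;> intro h <;> linarith

variable [TopologicalSpace X]

theorem continuous_coneGauge (hL : ∀ k, Continuous fun p : X × (Fin m → ℝ) => L k p.1 p.2)
    (hsc : Continuous s) (hs : ∀ k x, 0 < L k x (s x)) :
    Continuous fun p : X × (Fin m → ℝ) => coneGauge L s p.1 p.2 := by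
  refine Continuous.finset_sup_apply fun k _ => continuous_real_toNNReal.comp ?_
  refine (hL k).neg.div ((hL k).comp (g := fun p : X × (Fin m → ℝ) => L k p.1 p.2)
    (f := fun p : X × (Fin m → ℝ) => (p.1, s p.1)) (by fun_prop)) fun p => (hs k p.1).ne'

/-- A family of open polyhedral cones with a continuous section is a trivial fibration. -/
noncomputable def polyhedralHomeomorph
    (hL : ∀ k, Continuous fun p : X × (Fin m → ℝ) => L k p.1 p.2)
    (hsc : Continuous s) (hs : ∀ k x, 0 < L k x (s x)) :
    {p : X × (Fin m → ℝ) | ∀ k, 0 < L k p.1 p.2} ≃ₜ X × (Fin m → ℝ) where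
  -- With `g` the gauge, `v ↦ v / (1 - g v)` stretches `{g < 1}` onto the whole space; homogeneity
  -- makes `v ↦ v / (1 + g v)` its inverse.
  toFun p := (p.1.1, (1 - (coneGauge L s p.1.1 (p.1.2 - s p.1.1) : ℝ))⁻¹ • (p.1.2 - s p.1.1))
  invFun p := ⟨(p.1, s p.1 + ((1 + coneGauge L s p.1 p.2)⁻¹ : NNReal) • p.2), by
    refine (coneGauge_lt_one_iff (hs · p.1) _).1 ?_
    rw [NNReal.smul_def, coneGauge_smul, ← div_eq_inv_mul, div_lt_one (by positivity)]
    exact lt_one_add _⟩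
  left_inv := by
    rintro ⟨⟨x, y⟩, hp⟩
    have h1 : coneGauge L s x (y - s x) < 1 := by
      rw [coneGauge_lt_one_iff (hs · x)]
      simpa using hp
    set g := coneGauge L s x (y - s x) with hg
    have h2 : 0 < 1 - (g : ℝ) := sub_pos.2 (by exact_mod_cast h1)
    have h3 : (1 - (g : ℝ))⁻¹ = ((1 - g)⁻¹ : NNReal) := by
      rw [NNReal.coe_inv, NNReal.coe_sub h1.le, NNReal.coe_one]
    refine Subtype.ext (Prod.ext rfl ?_)
    simp only
    rw [← hg, h3, coneGauge_smul, ← hg, NNReal.smul_def, smul_smul, NNReal.coe_inv,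
      NNReal.coe_add, NNReal.coe_mul, ← h3]
    have h4 : ((1 : NNReal) + (1 - (g : ℝ))⁻¹ * g)⁻¹ * (1 - (g : ℝ))⁻¹ = 1 := by
      push_cast
      field_simp
      ring
    rw [h4, one_smul]
    abel
  right_inv := by
    rintro ⟨x, v⟩
    simp only [add_sub_cancel_left]
    refine Prod.ext rfl ?_
    simp only
    rw [NNReal.smul_def, coneGauge_smul, smul_smul]
    set g := coneGauge L s x v
    have h0 : (0 : ℝ) ≤ g := g.2
    have h4 : (1 - (((1 + g)⁻¹ * g : NNReal) : ℝ))⁻¹ * ((1 + g)⁻¹ : NNReal) = 1 := by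
      push_cast
      have : (1 : ℝ) + g ≠ 0 := by positivity
      field_simp
      ring_nf
    rw [h4, one_smul]
  continuous_toFun := by
    have hc := continuous_coneGauge hL hsc hs
    have hd : Continuous fun p : {p : X × (Fin m → ℝ) | ∀ k, 0 < L k p.1 p.2} =>
        coneGauge L s p.1.1 (p.1.2 - s p.1.1) :=
      hc.comp (f := fun p : {p : X × (Fin m → ℝ) | ∀ k, 0 < L k p.1 p.2} =>
        (p.1.1, p.1.2 - s p.1.1)) (by fun_prop)
    have hd' : Continuous fun p : {p : X × (Fin m → ℝ) | ∀ k, 0 < L k p.1 p.2} =>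
        (1 - (coneGauge L s p.1.1 (p.1.2 - s p.1.1) : ℝ))⁻¹ := by
      refine (continuous_const.sub (NNReal.continuous_coe.comp hd)).inv₀ ?_
      rintro ⟨⟨x, y⟩, hp⟩
      have h1 : coneGauge L s x (y - s x) < 1 := by
        rw [coneGauge_lt_one_iff (hs · x)]
        simpa using hp
      exact (sub_pos.2 (by exact_mod_cast h1)).ne'
    fun_prop
  continuous_invFun := by
    have hc := continuous_coneGauge hL hsc hs
    have hc' : Continuous fun p : X × (Fin m → ℝ) => (1 + coneGauge L s p.1 p.2)⁻¹ :=
      (continuous_const.add hc).inv₀ fun p => (add_pos_of_pos_of_nonneg one_pos zero_le).ne'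
    fun_prop

theorem fibration_of_polyhedral_cones [TopologicalSpace Z] [NormalSpace X] [ParacompactSpace X]
    (hL : ∀ k, Continuous fun p : X × (Fin m → ℝ) => L k p.1 p.2)
    (hne : ∀ x, ∃ y, ∀ k, 0 < L k x y) {q : Z → X × (Fin m → ℝ)}
    (hq : Topology.IsEmbedding q) (hr : Set.range q = {p | ∀ k, 0 < L k p.1 p.2}) :
    IsRealFibration m (fun z => (q z).1) ∧ IsHomotopyEquivalence (fun z => (q z).1) := by
  -- The fibers are convex, and a point of one fiber stays in the nearby ones, so local constant
  -- sections glue by a partition of unity.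
  obtain ⟨s, hs⟩ := exists_continuous_forall_mem_convex_of_local_const
    (t := fun x : X => {y : Fin m → ℝ | ∀ k, 0 < L k x y}) (fun x => by
      intro y hy z hz a b ha hb hab k
      rw [map_add, map_smul, map_smul, smul_eq_mul, smul_eq_mul]
      rcases ha.eq_or_lt with rfl | ha
      · have : b = 1 := by linarith
        simpa [this] using hz k
      · have := mul_pos ha (hy k)
        have := mul_nonneg hb (hz k).le
        linarith) (fun x => by
      obtain ⟨y, hy⟩ := hne x
      refine ⟨y, Filter.eventually_all.2 fun k => ?_⟩
      have hc : Continuous fun x => L k x y := (hL k).comp (f := fun x => (x, y)) (by fun_prop)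
      exact hc.continuousAt.eventually (lt_mem_nhds (hy k)))
  let e := (hq.toHomeomorph.trans (Homeomorph.setCongr hr)).trans
    (polyhedralHomeomorph hL s.continuous fun k x => hs x k)
  exact ⟨isRealFibration_of_homeomorph e fun _ => rfl,
    isHomotopyEquivalence_of_homeomorph e fun _ => rfl⟩

end Fibration

/-! ### Dependence on the calibration: openness and the fibration. -/

section Continuity

variable {d m : ℕ} {D : Set (Finset (Idx d m))}

theorem continuous_gen (i : Idx d m) : Continuous fun h : Calibration d m => gen h i := by
  rcases i with i | j
  · exact continuous_const
  · exact continuous_apply j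

theorem continuous_facetMatrix {I : Finset (Idx d m)} (hI : I.card = d) :
    Continuous fun h : Calibration d m => facetMatrix h I hI := by
  refine continuous_matrix fun r s => ?_
  exact (EuclideanSpace.proj s).continuous.comp (continuous_gen _)

theorem isOpen_nondegenerate : IsOpen (nondegenerate D) := by
  have : nondegenerate D = ⋂ I : {I : Finset (Idx d m) // I ∈ D ∧ I.card = d},
      {h | (facetMatrix h I.1 I.2.2).det ≠ 0} := by
    ext h
    simp only [nondegenerate, Set.mem_ofPred_eq, Set.mem_iInter, Subtype.forall]
    refine ⟨fun H I hI => ?_, fun H I hI hc => ?_⟩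
    · exact ((isUnit_det_facetMatrix_iff hI.2).2 (H I hI.1 hI.2)).ne_zero
    · exact (isUnit_det_facetMatrix_iff hc).1 (isUnit_iff_ne_zero.2 (H I ⟨hI, hc⟩))
  rw [this]
  exact isOpen_iInter_of_finite fun I =>
    isOpen_ne_fun (continuous_facetMatrix _).matrix_det continuous_const

/-- Cramer's rule: the inverse matrix is the adjugate divided by the determinant, which does not
vanish on `nondegenerate D`. -/
theorem continuousOn_slack {I : Finset (Idx d m)} (hI : I ∈ D) (hc : I.card = d) (i : Idx d m) :
    ContinuousOn (fun p : Calibration d m × (Fin m → ℝ) => slack p.1 I i (liftClass d m p.2))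
      {p | p.1 ∈ nondegenerate D} := by
  have hM : Continuous fun p : Calibration d m × (Fin m → ℝ) => facetMatrix p.1 I hc :=
    (continuous_facetMatrix hc).comp continuous_fst
  have hlift : Continuous (liftClass d m) := LinearMap.continuous_of_finiteDimensional _
  have hdet : ContinuousOn (fun p : Calibration d m × (Fin m → ℝ) => (facetMatrix p.1 I hc).det⁻¹)
      {p | p.1 ∈ nondegenerate D} := hM.matrix_det.continuousOn.inv₀ fun p hp =>
    ((isUnit_det_facetMatrix_iff hc).2 (hp I hI hc)).ne_zero
  have hinv : ContinuousOn (fun p : Calibration d m × (Fin m → ℝ) => (facetMatrix p.1 I hc)⁻¹)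
      {p | p.1 ∈ nondegenerate D} := by
    simp only [Matrix.inv_def, Ring.inverse_eq_inv']
    exact hdet.smul hM.matrix_adjugate.continuousOn
  have hvert : ContinuousOn (fun p : Calibration d m × (Fin m → ℝ) =>
      vertex p.1 I (liftClass d m p.2)) {p | p.1 ∈ nondegenerate D} := by
    have h1 : ∀ p : Calibration d m × (Fin m → ℝ), vertex p.1 I (liftClass d m p.2) =
        WithLp.toLp 2 (Matrix.mulVec (facetMatrix p.1 I hc)⁻¹
          fun r => -liftClass d m p.2 ((I.equivFinOfCardEq hc).symm r)) := by
      intro p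
      simp only [vertex, hc, dite_true]
      rfl
    simp only [h1]
    refine (PiLp.continuous_toLp 2 _).comp_continuousOn ?_
    rw [continuousOn_iff_continuous_domRestrict] at hinv ⊢
    exact hinv.matrix_mulVec (by
      refine continuous_pi fun r => ?_
      exact ((continuous_apply _).comp (hlift.comp
        (continuous_snd.comp continuous_subtype_val))).neg)
  simp only [slack_apply]
  refine (hvert.inner (𝕜 := ℝ) ((continuous_gen i).comp continuous_fst).continuousOn).add ?_
  exact ((continuous_apply i).comp (hlift.comp continuous_snd)).continuousOn

theorem isOpen_setOf_mem_chamber :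
    IsOpen {p : Calibration d m × (Fin m → ℝ) | p.1 ∈ nondegenerate D ∧ p.2 ∈ chamber D p.1} := by
  let S : Set (Calibration d m × (Fin m → ℝ)) := {p | p.1 ∈ nondegenerate D}
  have hS : IsOpen S := isOpen_nondegenerate.preimage continuous_fst
  have : {p : Calibration d m × (Fin m → ℝ) | p.1 ∈ nondegenerate D ∧ p.2 ∈ chamber D p.1} =
      S ∩ ⋂ I ∈ {I | I ∈ D ∧ I.card = d}, ⋂ i ∈ {i | i ∉ I},
        (S ∩ (fun p : Calibration d m × (Fin m → ℝ) => slack p.1 I i (liftClass d m p.2)) ⁻¹'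
          Set.Ioi 0) := by
    ext p
    simp only [S, chamber, Set.mem_inter_iff, Set.mem_iInter, Set.mem_ofPred_eq, Set.mem_preimage,
      Set.mem_Ioi, and_imp]
    exact and_congr_right fun hp => forall₅_congr fun I hI hc i hi => by simp [hp]
  rw [this]
  exact hS.inter ((Set.toFinite _).isOpen_biInter fun I hI => (Set.toFinite _).isOpen_biInter
    fun i _ => (continuousOn_slack hI.1 hI.2 i).isOpen_inter_preimage hS isOpen_Ioi)

/-- Leaving the base `B` free up to an equality of sets covers `proj` and `projAdmissible` at once:
in the last claim `admissibleSet H D` equals `omega H D`. -/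
theorem fibration_omegaHat {H : Set (Calibration d m)} (hT : IsThinComplex D)
    {B : Set (Calibration d m)} (hB : B = omega H D) {p : omegaHat H D → B}
    (hp : ∀ z, (p z : Calibration d m) = z.1.1) :
    IsRealFibration m p ∧ IsHomotopyEquivalence p := by
  classical
  subst hB
  let κ := {k : Finset (Idx d m) × Idx d m // k.1 ∈ D ∧ k.1.card = d ∧ k.2 ∉ k.1}
  let L : κ → omega H D → (Fin m → ℝ) →ₗ[ℝ] ℝ := fun k h => slack h.1 k.1.1 k.1.2 ∘ₗ liftClass d m
  have hmem : ∀ (h : omega H D) χ, (∀ k, 0 < L k h χ) ↔ χ ∈ chamber D h.1 := by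
    intro h χ
    constructor
    · exact fun H I hI hc i hi => H ⟨(I, i), hI, hc, hi⟩
    · exact fun H k => H _ k.2.1 k.2.2.1 _ k.2.2.2
  have hL : ∀ k, Continuous fun p : omega H D × (Fin m → ℝ) => L k p.1 p.2 := fun k =>
    (continuousOn_slack k.2.1 k.2.2.1 k.1.2).comp_continuous
      (f := fun p : omega H D × (Fin m → ℝ) => ((p.1 : Calibration d m), p.2)) (by fun_prop)
      fun p => nondegenerate_of_mem_omega hT p.1.2
  have hq : Topology.IsEmbedding fun z : omegaHat H D => (p z, z.1.2) := by
    have h1 : Topology.IsEmbedding fun z : omegaHat H D => z.1 := Topology.IsEmbedding.subtypeVal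
    have h2 : Continuous fun z : omegaHat H D => (p z, z.1.2) := by
      refine Continuous.prodMk (Topology.IsInducing.subtypeVal.continuous_iff.2 ?_) (by fun_prop)
      have : (Subtype.val ∘ p) = fun z : omegaHat H D => z.1.1 := funext hp
      rw [this]; fun_prop
    refine Topology.IsEmbedding.of_comp h2 (g := fun y : omega H D × (Fin m → ℝ) =>
      ((y.1 : Calibration d m), y.2)) (by fun_prop) ?_
    convert h1 using 1
    funext z
    exact Prod.ext (hp z) rfl
  refine fibration_of_polyhedral_cones (L := L) hL (fun h => ?_) hq ?_
  · obtain ⟨χ, hχ⟩ := chamber_nonempty hT h.2.1.2 (nondegenerate_of_mem_omega hT h.2) h.2.2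
    exact ⟨χ, (hmem h χ).2 hχ⟩
  · ext ⟨h, χ⟩
    simp only [Set.mem_range, Set.mem_ofPred_eq, hmem]
    rw [← mem_omegaHat_iff_of_mem_omega hT h.2]
    constructor
    · rintro ⟨z, hz⟩
      have h1 : p z = h := congrArg Prod.fst hz
      have h2 : z.1.2 = χ := congrArg Prod.snd hz
      rw [← h1, ← h2, hp z]
      exact z.2
    · intro hz
      exact ⟨⟨_, hz⟩, Prod.ext (Subtype.ext (hp _)) rfl⟩

end Continuity

end QuantumFan

/-! ### The main theorem. -/

theorem mainTheorem4 (d m : ℕ) (H : Set (QuantumFan.Calibration d m))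
    (hH : H = QuantumFan.nonzeroCalibrations d m ∨ H = QuantumFan.geometricCalibrations d m)
    (D : Set (Finset (QuantumFan.Idx d m))) (hD : QuantumFan.IsSimplicialPolytopalType D) :
    -- `Ω̂(D)` is an open subset of `U^{adm}`
    (QuantumFan.omegaHat H D ⊆ QuantumFan.admissiblePairs H ∧
      IsOpen {p : QuantumFan.admissiblePairs H | p.1 ∈ QuantumFan.omegaHat H D}) ∧
    -- membership in the chamber means having the combinatorics `D`
    (∀ h ∈ QuantumFan.omega H D, ∀ b, (h, QuantumFan.galeT h b) ∈ QuantumFan.omegaHat H D ↔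
      QuantumFan.faceType h b = D) ∧
    -- the fibers of `Ω̂(D) → Ω(D)` are nonempty open convex cones
    (∀ h ∈ QuantumFan.omega H D,
      {χ | (h, χ) ∈ QuantumFan.omegaHat H D}.Nonempty ∧
      IsOpen {χ | (h, χ) ∈ QuantumFan.omegaHat H D} ∧
      Convex ℝ {χ | (h, χ) ∈ QuantumFan.omegaHat H D} ∧
      ∀ c : ℝ, 0 < c → ∀ χ, (h, χ) ∈ QuantumFan.omegaHat H D →
        (h, c • χ) ∈ QuantumFan.omegaHat H D) ∧
    -- the projection `Ω̂(D) → Ω(D)` is an `ℝ^{n-d}`-fibration and a homotopy equivalence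
    (QuantumFan.IsRealFibration m (QuantumFan.proj H D) ∧
      QuantumFan.IsHomotopyEquivalence (QuantumFan.proj H D)) ∧
    -- in particular, so is the projection onto the set of all `D`-admissible calibrations as soon
    -- as all their fans of combinatorial type `D` have a strictly convex support function
    ((∀ h ∈ QuantumFan.admissibleSet H D, QuantumFan.IsPolytopal (QuantumFan.fanOf D h)) →
      QuantumFan.IsRealFibration m (QuantumFan.projAdmissible H D) ∧
      QuantumFan.IsHomotopyEquivalence (QuantumFan.projAdmissible H D)) := by
  have hT := hD.isThinComplex
  refine ⟨⟨fun p hp => hp.1, ?_⟩, fun h hh b => ?_, fun h hh => ?_, ?_, fun hpoly => ?_⟩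
  · have : {p : QuantumFan.admissiblePairs H | p.1 ∈ QuantumFan.omegaHat H D} =
        Subtype.val ⁻¹' {p : QuantumFan.Calibration d m × (Fin m → ℝ) |
          p.1 ∈ QuantumFan.nondegenerate D ∧ p.2 ∈ QuantumFan.chamber D p.1} := by
      ext p
      exact (QuantumFan.mem_omegaHat_iff hT).trans ⟨fun h => h.2, fun h => ⟨p.2.1, h⟩⟩
    rw [this]
    exact QuantumFan.isOpen_setOf_mem_chamber.preimage continuous_subtype_val
  · rw [QuantumFan.mem_omegaHat_iff_of_mem_omega hT hh]
    exact QuantumFan.mem_chamber_iff_faceType_eq hT (QuantumFan.nondegenerate_of_mem_omega hT hh)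
  · have hli := QuantumFan.nondegenerate_of_mem_omega hT hh
    simp only [QuantumFan.mem_omegaHat_iff_of_mem_omega hT hh]
    refine ⟨QuantumFan.chamber_nonempty hT hh.1.2 hli hh.2, QuantumFan.isOpen_chamber,
      QuantumFan.convex_chamber, fun c hc χ hχ => QuantumFan.smul_mem_chamber hc hχ⟩
  · exact QuantumFan.fibration_omegaHat hT rfl fun _ => rfl
  · refine QuantumFan.fibration_omegaHat hT ?_ fun _ => rfl
    exact Set.Subset.antisymm (fun h hh => ⟨hh, hpoly h hh⟩) fun h hh => hh.1
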